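/- Let $k$ be an algebraically closed field of characteristic $p>5$ and $\mathbb P^1=\mathbb P^1_k$. All points below are closed points of $\mathbb P^1$. A pair $(X,\Delta)$, where $X$ is a normal proper variety over $k$ and $\Delta$ is an effective $\mathbb Q$-divisor on $X$, is called *globally $F$-regular* if for every effective divisor $E$ on $X$ there is an integer $e>0$ such that the natural map $\mathcal O_X\to F^e_*\mathcal O_X(\lceil (p^e-1)\Delta\rceil+E)$ splits as a map of $\mathcal O_X$-modules, $F$ being the absolute Frobenius morphism of $X$. Then the pair $(\mathbb P^1,D)$ is globally $F$-regular in each of the following cases: 1. $D=\frac25P_1+\frac23P_2+\frac56P_3$ with $P_1,P_2,P_3$ pairwise distinct; 2. $D=\frac13P_1+\frac34P_2+\frac34P_3$ with $P_1,P_2,P_3$ pairwise distinct; 3. $D=\sum_{i=1}^r\frac{d_i-1}{d_i}P_i$ with $r\le 2$, the points $P_1,\dots,P_r$ pairwise distinct, and $d_1,\dots,d_r$ arbitrary positive integers; 4. $D=\sum_{i=1}^3\frac{d_i-1}{d_i}P_i$ with $P_1,P_2,P_3$ pairwise distinct and $(d_1,d_2,d_3)=(2,2,d)$ for some integer $d\ge1$,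 or $(d_1,d_2,d_3)\in\{(2,3,3),(2,3,4),(2,3,5)\}$. -/

import Mathlib

open AlgebraicGeometry CategoryTheory

universe u

noncomputable section

/-! ### Normal schemes and the sheaves `𝒪_X(E)` -/

/-- An integral scheme is normal if all its local rings are integrally closed domains. -/
class IsNormalScheme (X : Scheme.{u}) [IsIntegral X] : Prop where
  isIntegrallyClosed_stalk : ∀ x : X, IsIntegrallyClosed (X.presheaf.stalk x)

section Divisors

variable {X : Scheme.{u}} [IsIntegral X] [IsLocallyNoetherian X]

/-- A cycle with coefficients in `R` is a (Weil) divisor if it is a combination of points of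
codimension one, that is, of (generic points of) prime divisors. -/
def IsWeilDivisor {R : Type*} [Zero R] (D : AlgebraicCycle X R) : Prop :=
  ∀ x : X, D x ≠ 0 → Order.coheight x = 1

theorem isDiscreteValuationRing_stalk [IsNormalScheme X] {x : X} (hx : Order.coheight x = 1) :
    IsDiscreteValuationRing (X.presheaf.stalk x) := by
  have := IsNormalScheme.isIntegrallyClosed_stalk x
  have hk : Ring.KrullDimLE 1 (X.presheaf.stalk x) := krullDimLE_of_coheight_le hx.le
  have hd : ringKrullDim (X.presheaf.stalk x) = 1 := by
    rw [ringKrullDim_stalk_eq_coheight, hx]; rfl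
  have hf : ¬ IsField (X.presheaf.stalk x) := by
    intro h
    rw [ringKrullDim_eq_zero_of_isField h] at hd
    exact zero_ne_one hd
  have hl : Ring.DimensionLEOne (X.presheaf.stalk x) :=
    ⟨fun hP hP' => hP'.isMaximal_of_ne_bot hP⟩
  have hD : IsDedekindDomain (X.presheaf.stalk x) := { }
  exact ((IsDiscreteValuationRing.TFAE _ hf).out 0 2).mpr hD

/-- The sections over `U` of the sheaf `𝒪_X(E)` attached to an integral divisor `E`: the rational
functions `f` with `f = 0` or `(div f + E)|_U ≥ 0`, as a `Γ(X, U)`-submodule of the function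
field. -/
def divisorialSections [IsNormalScheme X] (E : X → ℤ) (U : X.Opens) [Nonempty U] :
    Submodule Γ(X, U) X.functionField where
  carrier := {f | f = 0 ∨ ∀ x ∈ U, Order.coheight x = 1 → 0 ≤ Scheme.ord f x + E x}
  zero_mem' := Or.inl rfl
  add_mem' := by
    intro f g hf hg
    by_cases h : f + g = 0
    · exact Or.inl h
    rcases hf with rfl | hf
    · simpa using hg
    rcases hg with rfl | hg
    · rw [add_zero]; exact Or.inr hf
    refine Or.inr fun x hx hc => ?_
    have := isDiscreteValuationRing_stalk hc
    have h1 := Scheme.ord_add (x := x) h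
    have h2 := hf x hx hc
    have h3 := hg x hx hc
    rcases min_le_iff.mp h1 with h4 | h4 <;> omega
  smul_mem' := by
    intro a f hf
    rcases hf with rfl | hf
    · exact Or.inl (smul_zero a)
    by_cases ha : a = 0
    · subst ha
      exact Or.inl (zero_smul _ f)
    refine Or.inr fun x hx hc => ?_
    have h1 := Scheme.ord_le_smul hx ha f
    have h2 := hf x hx hc
    omega

theorem divisorialSections_mono_open [IsNormalScheme X] (E : X → ℤ) {U V : X.Opens} [Nonempty U]
    [Nonempty V] (h : V ≤ U) {f : X.functionField} (hf : f ∈ divisorialSections E U) :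
    f ∈ divisorialSections E V :=
  hf.imp id fun hf x hx hc => hf x (h hx) hc

/-! ### Global F-regularity -/

/-- A splitting of the natural map `𝒪_X → F^e_* 𝒪_X(E)`, `s ↦ s ^ p ^ e`, where `F` is the
absolute Frobenius of a scheme of characteristic `p`. As `F` is the identity on the underlying
space, an `𝒪_X`-linear map `F^e_* 𝒪_X(E) → 𝒪_X` is a family of additive maps
`φ_U : Γ(U, 𝒪_X(E)) → Γ(U, 𝒪_X)`, compatible with restriction and with
`φ_U (a ^ p ^ e * f) = a * φ_U f`. Over the empty set both sheaves vanish, so that only nonempty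
open sets matter. -/
structure FrobeniusSplitting [IsNormalScheme X] (p e : ℕ) (E : X → ℤ) where
  /-- the map on sections over `U` -/
  map : ∀ (U : X.Opens) [Nonempty U], divisorialSections E U →+ Γ(X, U)
  map_smul : ∀ (U : X.Opens) [Nonempty U] (a : Γ(X, U)) (f : divisorialSections E U),
    map U (a ^ p ^ e • f) = a * map U f
  map_restrict : ∀ (U V : X.Opens) [Nonempty U] [Nonempty V] (h : V ≤ U)
    (f : divisorialSections E U),
    map V ⟨f, divisorialSections_mono_open E h f.2⟩ = X.presheaf.map (homOfLE h).op (map U f)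
  map_frobenius : ∀ (U : X.Opens) [Nonempty U] (s : Γ(X, U)),
    ∃ hs : X.germToFunctionField U s ^ p ^ e ∈ divisorialSections E U, map U ⟨_, hs⟩ = s

/-- A pair `(X, Δ)`, with `X` a normal scheme of characteristic `p` and `Δ` an effective
`ℚ`-divisor, is globally F-regular if for every effective (integral) divisor `D` there is an
`e > 0` such that the natural map `𝒪_X → F^e_* 𝒪_X(⌈(p ^ e - 1) Δ⌉ + D)` splits. -/
structure IsGloballyFRegular [IsNormalScheme X] (p : ℕ) (Δ : AlgebraicCycle X ℚ) : Prop where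
  isWeilDivisor : IsWeilDivisor Δ
  effective : 0 ≤ Δ
  splits : ∀ D : AlgebraicCycle X ℤ, IsWeilDivisor D → 0 ≤ D →
    ∃ e : ℕ, 0 < e ∧
      Nonempty (FrobeniusSplitting (X := X) p e fun x => ⌈((p : ℚ) ^ e - 1) * Δ x⌉ + D x)

open Classical in
/-- The `ℚ`-divisor `∑ c_i P_i`. -/
def pointDivisor {r : ℕ} (P : Fin r → X) (c : Fin r → ℚ) : AlgebraicCycle X ℚ :=
  ∑ i, Function.locallyFinsuppWithin.single (P i) (c i)

end Divisors

/-! ### The projective line -/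

attribute [local instance] MvPolynomial.gradedAlgebra

/-- The projective line `ℙ¹_k = Proj k[x₀, x₁]`. -/
abbrev ProjectiveLine (k : Type u) [Field k] : Scheme.{u} :=
  Proj (MvPolynomial.homogeneousSubmodule (Fin 2) k)

namespace ProjectiveLine

variable (k : Type u) [Field k]

/-- the homogeneous coordinate ring -/
local notation "𝒜" => MvPolynomial.homogeneousSubmodule (Fin 2) k

instance : IrreducibleSpace (ProjectiveLine k) := by
  have hX : (MvPolynomial.X 0 : MvPolynomial (Fin 2) k) ∈ 𝒜 1 := MvPolynomial.isHomogeneous_X k 0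
  let η : ProjectiveSpectrum 𝒜 :=
    { asHomogeneousIdeal := ⊥
      isPrime := by rw [HomogeneousIdeal.toIdeal_bot]; exact Ideal.isPrime_bot
      not_irrelevant_le := fun h => by
        have h1 : (MvPolynomial.X 0 : MvPolynomial (Fin 2) k) ∈ HomogeneousIdeal.irrelevant 𝒜 :=
          (HomogeneousIdeal.mem_irrelevant_iff _ _).mpr (by
            rw [GradedRing.proj_apply]
            exact DirectSum.decompose_of_mem_ne 𝒜 hX one_ne_zero)
        exact MvPolynomial.X_ne_zero 0 (h h1) }
  have hη : closure ({η} : Set (ProjectiveSpectrum 𝒜)) = Set.univ := by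
    refine Set.eq_univ_of_forall fun x => ?_
    rw [← ProjectiveSpectrum.le_iff_mem_closure, ← ProjectiveSpectrum.as_ideal_le_as_ideal]
    exact bot_le
  rw [irreducibleSpace_def]
  change IsIrreducible (Set.univ : Set (ProjectiveSpectrum 𝒜))
  rw [← hη]
  exact isIrreducible_singleton.closure

theorem isDomain_homogeneousLocalization (S : Submonoid (MvPolynomial (Fin 2) k)) (hS : 0 ∉ S) :
    IsDomain (HomogeneousLocalization 𝒜 S) := by
  have hS' : S ≤ nonZeroDivisors (MvPolynomial (Fin 2) k) :=
    fun x hx => mem_nonZeroDivisors_of_ne_zero fun h => hS (h ▸ hx)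
  have : IsDomain (Localization S) := IsLocalization.isDomain_localization hS'
  exact Function.Injective.isDomain
    (algebraMap (HomogeneousLocalization 𝒜 S) (Localization S))
    (HomogeneousLocalization.val_injective S)

instance : IsReduced (ProjectiveLine k) := by
  have (x : ProjectiveLine k) : _root_.IsReduced ((ProjectiveLine k).presheaf.stalk x) := by
    have hp : (HomogeneousIdeal.toIdeal (ProjectiveSpectrum.asHomogeneousIdeal x)).IsPrime :=
      ProjectiveSpectrum.isPrime x
    have h := isDomain_homogeneousLocalization k
      (HomogeneousIdeal.toIdeal (ProjectiveSpectrum.asHomogeneousIdeal x)).primeCompl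
      (fun h => h (Ideal.zero_mem _))
    have h' : _root_.IsReduced (CommRingCat.of (HomogeneousLocalization.AtPrime 𝒜
      (HomogeneousIdeal.toIdeal (ProjectiveSpectrum.asHomogeneousIdeal x)))) :=
      @isReduced_of_noZeroDivisors _ _ h.to_noZeroDivisors
    exact isReduced_of_injective (Proj.stalkIso 𝒜 x).commRingCatIsoToRingEquiv
      (Proj.stalkIso 𝒜 x).commRingCatIsoToRingEquiv.injective
  exact isReduced_of_isReduced_stalk _

instance : IsIntegral (ProjectiveLine k) := isIntegral_of_irreducibleSpace_of_isReduced _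

theorem X_mem (i : Fin 2) : (MvPolynomial.X i : MvPolynomial (Fin 2) k) ∈ 𝒜 1 :=
  MvPolynomial.isHomogeneous_X k i

instance isDomain_away (i : Fin 2) :
    IsDomain (HomogeneousLocalization.Away 𝒜 (MvPolynomial.X i : MvPolynomial (Fin 2) k)) :=
  isDomain_homogeneousLocalization k _ fun ⟨_, h⟩ => pow_ne_zero _ (MvPolynomial.X_ne_zero i) h

theorem eval₂_mul_of_isHomogeneous {R : Type u} [CommRing R] (f : k →+* R) (r : R)
    (g : Fin 2 → R) {n : ℕ} {a : MvPolynomial (Fin 2) k} (ha : a.IsHomogeneous n) :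
    a.eval₂ f (fun j => r * g j) = r ^ n * a.eval₂ f g := by
  rw [MvPolynomial.eval₂_eq', MvPolynomial.eval₂_eq', Finset.mul_sum]
  refine Finset.sum_congr rfl fun d hd => ?_
  have hn : d 0 + d 1 = n := by
    have := ha (MvPolynomial.mem_support_iff.mp hd)
    simpa [Finsupp.weight_apply, Finsupp.sum_fintype] using this
  simp only [Fin.prod_univ_two, mul_pow, ← hn, pow_add]
  ring

/-- The degree zero part of `k[x₀, x₁]` localized at `x_i` is generated by one element over `k`,
hence it is a principal ideal ring. -/
instance isPrincipalIdealRing_away (i : Fin 2) : IsPrincipalIdealRing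
    (HomogeneousLocalization.Away 𝒜 (MvPolynomial.X i : MvPolynomial (Fin 2) k)) := by
  let A := MvPolynomial (Fin 2) k
  let S : Submonoid A := Submonoid.powers (MvPolynomial.X i)
  let B := HomogeneousLocalization.Away 𝒜 (MvPolynomial.X i : A)
  let al : A →+* Localization S := algebraMap A (Localization S)
  let ι : B →+* Localization S := algebraMap B (Localization S)
  let c : k →+* B := (HomogeneousLocalization.fromZeroRingHom 𝒜 _).comp (algebraMap k (𝒜 0))
  let t : B := HomogeneousLocalization.Away.mk 𝒜 (X_mem k i) 1 (MvPolynomial.X (1 - i))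
    (by simpa using X_mem k (1 - i))
  let ψ : Polynomial k →+* B := Polynomial.eval₂RingHom c t
  let P : A →+* Polynomial k :=
    MvPolynomial.eval₂Hom Polynomial.C (fun j => if j = i then 1 else Polynomial.X)
  let v : Localization S := Localization.mk 1 ⟨MvPolynomial.X i, Submonoid.mem_powers _⟩
  have hv : v * al (MvPolynomial.X i) = 1 := by
    change Localization.mk _ _ * algebraMap A _ _ = 1
    rw [← Localization.mk_one_eq_algebraMap, Localization.mk_mul, one_mul, mul_one]
    exact Localization.mk_self ⟨MvPolynomial.X i, Submonoid.mem_powers _⟩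
  have key : (ι.comp ψ).comp P =
      MvPolynomial.eval₂Hom (al.comp MvPolynomial.C) (fun j => v * al (MvPolynomial.X j)) := by
    refine MvPolynomial.ringHom_ext (fun r => ?_) (fun j => ?_)
    · have h1 : P (MvPolynomial.C r) = Polynomial.C r := MvPolynomial.eval₂Hom_C _ _ _
      have h2 : ψ (Polynomial.C r) = c r := Polynomial.eval₂_C _ _
      rw [RingHom.comp_apply, RingHom.comp_apply, h1, h2, MvPolynomial.eval₂Hom_C]
      exact Localization.mk_one_eq_algebraMap _
    · rw [RingHom.comp_apply, RingHom.comp_apply, MvPolynomial.eval₂Hom_X',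
        MvPolynomial.eval₂Hom_X']
      by_cases hj : j = i
      · rw [if_pos hj, map_one, map_one, hj, hv]
      · have hj' : 1 - i = j := by omega
        have h2 : ψ Polynomial.X = t := Polynomial.eval₂_X _ _
        rw [if_neg hj, h2]
        change Localization.mk _ _ = Localization.mk _ _ * algebraMap A _ _
        rw [← Localization.mk_one_eq_algebraMap, Localization.mk_mul, one_mul, mul_one, hj']
        congr 1
        exact Subtype.ext (pow_one _)
  refine IsPrincipalIdealRing.of_surjective ψ fun z => ?_
  obtain ⟨n, a, ha, rfl⟩ := HomogeneousLocalization.Away.mk_surjective 𝒜 (X_mem k i) z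
  refine ⟨P a, HomogeneousLocalization.val_injective _ ?_⟩
  have ha' : a.IsHomogeneous n := by simpa using ha
  have h1 : ι (ψ (P a)) = v ^ n * al a := by
    have h := congrArg (fun f => f a) key
    have h3 := eval₂_mul_of_isHomogeneous k (al.comp MvPolynomial.C) v
      (fun j => al (MvPolynomial.X j)) ha'
    have h4 : a.eval₂ (al.comp MvPolynomial.C) (fun j => al (MvPolynomial.X j)) = al a := by
      have h5 := MvPolynomial.eval₂_comp_left al MvPolynomial.C MvPolynomial.X a
      rw [MvPolynomial.eval₂_eta] at h5
      exact h5.symm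
    rw [← h4, ← h3]
    exact h
  refine Eq.trans h1 ?_
  change Localization.mk _ _ ^ n * algebraMap A _ _ = Localization.mk _ _
  rw [← Localization.mk_one_eq_algebraMap, Localization.mk_pow, Localization.mk_mul, one_pow,
    one_mul, mul_one]
  rfl

theorem iSup_basicOpen_eq_top :
    (⨆ i : Fin 2, Proj.basicOpen 𝒜 (MvPolynomial.X i : MvPolynomial (Fin 2) k)) = ⊤ := by
  refine Proj.iSup_basicOpen_eq_top' 𝒜 _ (fun i => ⟨1, X_mem k i⟩) ?_
  refine top_le_iff.mp fun a _ => ?_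
  induction a using MvPolynomial.induction_on with
  | C r => exact Subalgebra.algebraMap_mem _ (algebraMap k (𝒜 0) r)
  | add a b ha hb => exact add_mem (ha trivial) (hb trivial)
  | mul_X a i ha => exact mul_mem (ha trivial) (Algebra.subset_adjoin ⟨i, rfl⟩)

theorem isPrincipalIdealRing_basicOpen (i : Fin 2) : IsPrincipalIdealRing
    Γ(ProjectiveLine k, Proj.basicOpen 𝒜 (MvPolynomial.X i : MvPolynomial (Fin 2) k)) :=
  IsPrincipalIdealRing.of_surjective
    (Proj.basicOpenIsoAway 𝒜 _ (X_mem k i) one_pos).commRingCatIsoToRingEquiv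
    (Proj.basicOpenIsoAway 𝒜 _ (X_mem k i) one_pos).commRingCatIsoToRingEquiv.surjective

instance : IsLocallyNoetherian (ProjectiveLine k) := by
  refine isLocallyNoetherian_of_affine_cover (S := fun i : Fin 2 =>
    ⟨Proj.basicOpen 𝒜 (MvPolynomial.X i : MvPolynomial (Fin 2) k),
      Proj.isAffineOpen_basicOpen 𝒜 _ (X_mem k i) one_pos⟩) (iSup_basicOpen_eq_top k) fun i => ?_
  have := isPrincipalIdealRing_basicOpen k i
  infer_instance

instance : IsNormalScheme (ProjectiveLine k) where
  isIntegrallyClosed_stalk x := by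
    obtain ⟨i, hi⟩ := TopologicalSpace.Opens.mem_iSup.mp
      ((iSup_basicOpen_eq_top k).ge (Set.mem_univ x))
    have hU := Proj.isAffineOpen_basicOpen 𝒜 _ (X_mem k i) one_pos
    have := isPrincipalIdealRing_basicOpen k i
    have : Nonempty (Proj.basicOpen 𝒜 (MvPolynomial.X i : MvPolynomial (Fin 2) k)) := ⟨⟨x, hi⟩⟩
    have hloc := hU.isLocalization_stalk ⟨x, hi⟩
    let _ := ((ProjectiveLine k).presheaf.algebra_section_stalk
      (⟨x, hi⟩ : Proj.basicOpen 𝒜 (MvPolynomial.X i : MvPolynomial (Fin 2) k)))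
    exact isIntegrallyClosed_of_isLocalization _
      (hU.primeIdealOf ⟨x, hi⟩).asIdeal.primeCompl (Ideal.primeCompl_le_nonZeroDivisors _)

end ProjectiveLine

end

/-! Let `q = p ^ e` and let `Tr` be the trace of the `e`-th Frobenius on `S = k[x₀, x₁]`, which
sends `(x₀ x₁) ^ (q - 1)` to `1`. Since the canonical bundle of the line is `𝒪(-2)`, a form `G` of
degree `2 (q - 1)` gives an `𝒪`-linear map `f ↦ Tr (G f)`. It is defined on `F^e_* 𝒪(E)` when `div G
≥ E`, and it splits Frobenius when `Tr G = 1` (`nonempty_frobeniusSplitting`). As in Fedder's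
criterion, a form `F` divides such a `G` as soon as `F ∉ (x₀ ^ q, x₁ ^ q)`; it is then called
compatible.

Compatibility multiplies: if `F` works for `e` and `H` for `e'`, then `F ^ p ^ e' * H` works for `e
+ e'` (`IsFrobeniusCompatible.pow_mul`). Every nonzero form `H` of degree `m` works for `e' = m`.
Hence one compatible `F` with `div F ≥ p ^ e Δ` handles every auxiliary divisor `D`: take for `H` a
form vanishing along `D` (`isGloballyFRegular_of_isFrobeniusCompatible`).

For three points, `F` is a product `u ^ a * v ^ b * w ^ c` of powers of linear forms. For `e = 1` it
is compatible if `a, b, c < p` and `a + b + c ≤ 2 (p - 1)`: in the coordinates `u, v` a suitable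
coefficient is a nonzero constant times a binomial coefficient prime to `p`. By multiplicativity it
is enough that these bounds hold digit by digit in base `p` (`HasSmallDigitSums`). It remains to
round the coefficients of `Δ` up to fractions `a / p ^ e` with small digit sums. One digit is enough
for large `p`, since the coefficients add up to less than `2`; the small `p` are a finite
computation. The cases `(2, 2, d)` and `r ≤ 2` have explicit digits. -/

namespace MvPolynomial

/-! ### The trace of Frobenius on polynomial rings and compatible forms. -/

noncomputable section

variable {σ k : Type*} [Fintype σ] [Field k] (p : ℕ) [ExpChar k p] [PerfectRing k p] (e : ℕ)

/-- The map `m ↦ q m + (q - 1, …, q - 1)` on exponents. -/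
def traceExponent (q : ℕ) (m : σ →₀ ℕ) : σ →₀ ℕ :=
  q • m + Finsupp.equivFunOnFinite.symm fun _ => q - 1

@[simp]
theorem traceExponent_apply (q : ℕ) (m : σ →₀ ℕ) (i : σ) :
    traceExponent q m i = q * m i + (q - 1) := by
  simp [traceExponent]

theorem traceExponent_injective {q : ℕ} (hq : 0 < q) :
    Function.Injective (traceExponent q : (σ →₀ ℕ) → σ →₀ ℕ) := by
  intro m n h
  ext i
  have := DFunLike.congr_fun h i
  simpa [hq.ne'] using this

omit [Fintype σ] in
theorem weight_one_eq_degree (m : σ →₀ ℕ) : Finsupp.weight (1 : σ → ℕ) m = m.degree :=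
  (DFunLike.congr_fun Finsupp.degree_eq_weight_one m).symm

theorem degree_traceExponent (q : ℕ) (m : σ →₀ ℕ) :
    (traceExponent q m).degree = q * m.degree + Fintype.card σ * (q - 1) := by
  simp [Finsupp.degree_eq_sum, Finset.sum_add_distrib, Finset.mul_sum]

/-- The trace of the `e`-th Frobenius of a polynomial ring over a perfect field: the generator of
the module of `p^{-e}`-linear endomorphisms, which sends `∏ x_i ^ (q - 1)` to `1`. -/
def frobeniusTrace : MvPolynomial σ k →+ MvPolynomial σ k where
  toFun f := .ofCoeff (Finsupp.mapRange (iterateFrobeniusEquiv k p e).symm (map_zero _)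
    (Finsupp.comapDomain (traceExponent (p ^ e)) (AddMonoidAlgebra.coeff f)
      (traceExponent_injective (pow_pos (expChar_pos k p) e)).injOn))
  map_zero' := by
    ext m
    exact map_zero (iterateFrobeniusEquiv k p e).symm
  map_add' f g := by
    ext m
    exact map_add (iterateFrobeniusEquiv k p e).symm _ _

theorem coeff_frobeniusTrace (f : MvPolynomial σ k) (m : σ →₀ ℕ) :
    coeff m (frobeniusTrace p e f) =
      (iterateFrobeniusEquiv k p e).symm (coeff (traceExponent (p ^ e) m) f) :=
  rfl

theorem frobeniusTrace_C_pow_mul (c : k) (f : MvPolynomial σ k) :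
    frobeniusTrace p e (C c ^ p ^ e * f) = C c * frobeniusTrace p e f := by
  ext m
  rw [coeff_frobeniusTrace, ← map_pow, coeff_C_mul, coeff_C_mul, coeff_frobeniusTrace, map_mul,
    ← iterateFrobeniusEquiv_def k p, RingEquiv.symm_apply_apply]

theorem frobeniusTrace_X_pow_mul (i : σ) (f : MvPolynomial σ k) :
    frobeniusTrace p e (X i ^ p ^ e * f) = X i * frobeniusTrace p e f := by
  classical
  have hq : 0 < p ^ e := pow_pos (expChar_pos k p) e
  ext m
  rw [coeff_frobeniusTrace, X_pow_eq_monomial, coeff_monomial_mul', coeff_X_mul',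
    coeff_frobeniusTrace, one_mul]
  by_cases h : m i = 0
  · rw [if_neg, if_neg (by simpa using h), map_zero]
    intro hle
    have := hle i
    simp [h] at this
    omega
  · rw [if_pos, if_pos (by simpa using h)]
    · congr 2
      ext j
      by_cases hj : i = j
      · subst hj
        obtain ⟨n, hn⟩ := Nat.exists_eq_succ_of_ne_zero h
        simp [hn, mul_add]
        omega
      · simp [hj]
    · rw [Finsupp.single_le_iff, traceExponent_apply]
      calc p ^ e = p ^ e * 1 := (mul_one _).symm
        _ ≤ p ^ e * m i := Nat.mul_le_mul_left _ (Nat.one_le_iff_ne_zero.mpr h)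
        _ ≤ _ := Nat.le_add_right _ _

theorem frobeniusTrace_pow_mul (a f : MvPolynomial σ k) :
    frobeniusTrace p e (a ^ p ^ e * f) = a * frobeniusTrace p e f := by
  induction a using MvPolynomial.induction_on generalizing f with
  | C c => exact frobeniusTrace_C_pow_mul p e c f
  | add a b ha hb => rw [add_pow_expChar_pow, add_mul, map_add, ha, hb, add_mul]
  | mul_X a i ha => rw [mul_pow, mul_assoc, ha, frobeniusTrace_X_pow_mul, mul_assoc]

theorem traceExponent_mul {q q' : ℕ} (h : 0 < q) (h' : 0 < q') (m : σ →₀ ℕ) :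
    traceExponent (q * q') m = traceExponent q' (traceExponent q m) := by
  ext i
  simp only [traceExponent_apply]
  zify [h, h', Nat.mul_pos h h']
  ring

theorem frobeniusTrace_add (e' : ℕ) (f : MvPolynomial σ k) :
    frobeniusTrace p (e + e') f = frobeniusTrace p e (frobeniusTrace p e' f) := by
  ext m
  rw [coeff_frobeniusTrace, coeff_frobeniusTrace, coeff_frobeniusTrace,
    iterateFrobeniusEquiv_symm_add_apply, pow_add,
    traceExponent_mul (pow_pos (expChar_pos k p) e) (pow_pos (expChar_pos k p) e')]

theorem frobeniusTrace_zero (f : MvPolynomial σ k) : frobeniusTrace p 0 f = f := by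
  ext m
  rw [coeff_frobeniusTrace, iterateFrobeniusEquiv_zero]
  change coeff _ f = coeff _ f
  congr 1
  ext i
  simp

variable {p e}

theorem IsHomogeneous.frobeniusTrace {f : MvPolynomial σ k} {d : ℕ}
    (hf : f.IsHomogeneous (p ^ e * d + Fintype.card σ * (p ^ e - 1))) :
    (frobeniusTrace p e f).IsHomogeneous d := by
  intro m hm
  rw [coeff_frobeniusTrace, ne_eq, map_eq_zero_iff _ (RingEquiv.injective _)] at hm
  have h := hf hm
  rw [weight_one_eq_degree, degree_traceExponent] at h
  rw [weight_one_eq_degree]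
  exact Nat.eq_of_mul_eq_mul_left (pow_pos (expChar_pos k p) e) (Nat.add_right_cancel h)

variable (p e)

/-- A form `F` is compatible with the `e`-th Frobenius if `F` divides a form `G` of degree
`n (q - 1)` for which the map `f ↦ Tr (G f)` is a splitting of the `e`-th Frobenius. -/
def IsFrobeniusCompatible (F : MvPolynomial σ k) : Prop :=
  ∃ G : MvPolynomial σ k, G.IsHomogeneous (Fintype.card σ * (p ^ e - 1)) ∧ F ∣ G ∧
    frobeniusTrace p e G = 1

variable {p e}

/-- Multiply by the complementary monomial `x ^ (q - 1 - m)`, scaled by the inverse of the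
coefficient. The trace of the product is a form of degree zero, hence a constant, and it is read off
from the coefficient at `(q - 1, …, q - 1)`. -/
theorem isFrobeniusCompatible_of_coeff_ne_zero {F : MvPolynomial σ k} {n : ℕ}
    (hF : F.IsHomogeneous n) {m : σ →₀ ℕ} (hm : coeff m F ≠ 0) (hlt : ∀ i, m i < p ^ e) :
    IsFrobeniusCompatible p e F := by
  let c : σ →₀ ℕ := Finsupp.equivFunOnFinite.symm fun i => p ^ e - 1 - m i
  have hmc : m + c = traceExponent (p ^ e) 0 := by
    ext i
    have := hlt i
    simp [c]
    omega
  have hdeg : n + c.degree = Fintype.card σ * (p ^ e - 1) := by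
    have h1 : m.degree = n := (weight_one_eq_degree m).symm.trans (hF hm)
    rw [← h1, ← map_add, hmc, degree_traceExponent]
    simp
  have hG : (F * monomial c (coeff m F)⁻¹).IsHomogeneous (Fintype.card σ * (p ^ e - 1)) :=
    hdeg ▸ hF.mul (isHomogeneous_monomial _ rfl)
  refine ⟨_, hG, dvd_mul_right _ _, ?_⟩
  have h0 : (frobeniusTrace p e (F * monomial c (coeff m F)⁻¹)).IsHomogeneous 0 :=
    IsHomogeneous.frobeniusTrace (by simpa using hG)
  rw [← totalDegree_zero_iff_isHomogeneous, totalDegree_eq_zero_iff_eq_C] at h0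
  rw [h0, coeff_frobeniusTrace, ← hmc, coeff_mul_monomial, mul_inv_cancel₀ hm, map_one, map_one]

theorem isFrobeniusCompatible_zero_one : IsFrobeniusCompatible p 0 (1 : MvPolynomial σ k) :=
  ⟨1, by simpa using isHomogeneous_one σ k, dvd_rfl, frobeniusTrace_zero p 1⟩

/-- Traces compose, so `Tr_{e+e'} (G ^ p ^ e' * G') = Tr_e (G * Tr_{e'} G') = Tr_e G = 1`. -/
theorem IsFrobeniusCompatible.pow_mul {F H : MvPolynomial σ k} {e' : ℕ}
    (hF : IsFrobeniusCompatible p e F) (hH : IsFrobeniusCompatible p e' H) :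
    IsFrobeniusCompatible p (e + e') (F ^ p ^ e' * H) := by
  obtain ⟨G, hG, hFG, hG1⟩ := hF
  obtain ⟨G', hG', hHG', hG1'⟩ := hH
  refine ⟨G ^ p ^ e' * G', ?_, mul_dvd_mul (pow_dvd_pow_of_dvd hFG _) hHG', ?_⟩
  · have h : 0 < p ^ e := pow_pos (expChar_pos k p) e
    have h' : 0 < p ^ e' := pow_pos (expChar_pos k p) e'
    convert! (hG.pow (p ^ e')).mul hG' using 1
    rw [pow_add]
    zify [h, h', Nat.mul_pos h h']
    ring
  · rw [frobeniusTrace_add, frobeniusTrace_pow_mul, hG1', mul_one, hG1]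

/-! ### Extension of the trace to the field of fractions. -/

section FractionField

variable (p e)

local notation "M" => FractionRing (MvPolynomial σ k)
local notation "ι" => algebraMap (MvPolynomial σ k) (FractionRing (MvPolynomial σ k))

omit [Fintype σ] in
theorem algebraMap_ne_zero_of_ne_zero {b : MvPolynomial σ k} (hb : b ≠ 0) : ι b ≠ 0 := by
  rwa [ne_eq, map_eq_zero_iff _ (IsFractionRing.injective (MvPolynomial σ k) M)]

/-- The extension is forced by `a / b = a b ^ (q - 1) / b ^ q` and `p^{-e}`-linearity; this is its
independence of the chosen fraction. -/
theorem frobeniusTrace_div_eq_div {a b c d : MvPolynomial σ k}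
    (hb : b ≠ 0) (hd : d ≠ 0) (h : ι a / ι b = ι c / ι d) :
    ι (frobeniusTrace p e (a * b ^ (p ^ e - 1))) / ι b =
      ι (frobeniusTrace p e (c * d ^ (p ^ e - 1))) / ι d := by
  have hq : 0 < p ^ e := pow_pos (expChar_pos k p) e
  rw [div_eq_div_iff (algebraMap_ne_zero_of_ne_zero hb)
    (algebraMap_ne_zero_of_ne_zero hd), ← map_mul, ← map_mul] at h ⊢
  have h1 : a * d = c * b := IsFractionRing.injective (MvPolynomial σ k) M h
  rw [mul_comm, mul_comm _ b, ← frobeniusTrace_pow_mul, ← frobeniusTrace_pow_mul]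
  obtain ⟨n, hn⟩ := Nat.exists_eq_succ_of_ne_zero hq.ne'
  rw [hn, Nat.succ_sub_one]
  congr 2
  rw [pow_succ, pow_succ]
  linear_combination b ^ n * d ^ n * h1

/-- The extension of the trace of Frobenius to the field of fractions. -/
def fractionFrobeniusTraceFun (f : M) : M :=
  ι (frobeniusTrace p e ((IsLocalization.sec (nonZeroDivisors (MvPolynomial σ k)) f).1 *
    ((IsLocalization.sec (nonZeroDivisors (MvPolynomial σ k)) f).2 : MvPolynomial σ k)
      ^ (p ^ e - 1))) / ι (IsLocalization.sec (nonZeroDivisors (MvPolynomial σ k)) f).2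

theorem fractionFrobeniusTraceFun_div (a : MvPolynomial σ k) {b : MvPolynomial σ k} (hb : b ≠ 0) :
    fractionFrobeniusTraceFun p e (ι a / ι b) =
      ι (frobeniusTrace p e (a * b ^ (p ^ e - 1))) / ι b := by
  have hs := nonZeroDivisors.coe_ne_zero
    (IsLocalization.sec (nonZeroDivisors (MvPolynomial σ k)) (ι a / ι b)).2
  refine frobeniusTrace_div_eq_div p e hs hb ?_
  rw [div_eq_iff (algebraMap_ne_zero_of_ne_zero hs)]
  exact (IsLocalization.sec_spec _ _).symm

/-- The extension of the trace of Frobenius to the field of fractions. -/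
def fractionFrobeniusTrace : M →+ M where
  toFun := fractionFrobeniusTraceFun p e
  map_zero' := by
    have := fractionFrobeniusTraceFun_div p e 0 (one_ne_zero : (1 : MvPolynomial σ k) ≠ 0)
    simpa using this
  map_add' f g := by
    obtain ⟨a, b, hb, rfl⟩ := IsFractionRing.div_surjective (A := MvPolynomial σ k) f
    obtain ⟨c, d, hd, rfl⟩ := IsFractionRing.div_surjective (A := MvPolynomial σ k) g
    have hb0 := nonZeroDivisors.ne_zero hb
    have hd0 := nonZeroDivisors.ne_zero hd
    have hb1 := algebraMap_ne_zero_of_ne_zero hb0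
    have hd1 := algebraMap_ne_zero_of_ne_zero hd0
    have h1 : ι a / ι b = ι (a * d) / ι (b * d) := by
      rw [map_mul, map_mul, mul_div_mul_right _ _ hd1]
    have h2 : ι c / ι d = ι (c * b) / ι (b * d) := by
      rw [map_mul, map_mul, mul_comm (ι b), mul_div_mul_right _ _ hb1]
    have hbd := mul_ne_zero hb0 hd0
    rw [h1, h2, ← add_div, ← map_add, fractionFrobeniusTraceFun_div _ _ _ hbd,
      fractionFrobeniusTraceFun_div _ _ _ hbd, fractionFrobeniusTraceFun_div _ _ _ hbd,
      add_mul, map_add, map_add, add_div]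

theorem fractionFrobeniusTrace_div (a : MvPolynomial σ k) {b : MvPolynomial σ k} (hb : b ≠ 0) :
    fractionFrobeniusTrace p e (ι a / ι b) =
      ι (frobeniusTrace p e (a * b ^ (p ^ e - 1))) / ι b :=
  fractionFrobeniusTraceFun_div p e a hb

theorem fractionFrobeniusTrace_algebraMap (a : MvPolynomial σ k) :
    fractionFrobeniusTrace p e (ι a) = ι (frobeniusTrace p e a) := by
  simpa using fractionFrobeniusTrace_div p e a one_ne_zero

theorem fractionFrobeniusTrace_pow_mul (c f : M) :
    fractionFrobeniusTrace p e (c ^ p ^ e * f) = c * fractionFrobeniusTrace p e f := by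
  obtain ⟨a, b, hb, rfl⟩ := IsFractionRing.div_surjective (A := MvPolynomial σ k) c
  obtain ⟨u, v, hv, rfl⟩ := IsFractionRing.div_surjective (A := MvPolynomial σ k) f
  have hb0 := nonZeroDivisors.ne_zero hb
  have hv0 := nonZeroDivisors.ne_zero hv
  have hb1 := algebraMap_ne_zero_of_ne_zero hb0
  have hv1 := algebraMap_ne_zero_of_ne_zero hv0
  have hq : 0 < p ^ e := pow_pos (expChar_pos k p) e
  have h1 : (ι a / ι b) ^ p ^ e * (ι u / ι v) = ι (a ^ p ^ e * u) / ι (b ^ p ^ e * v) := by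
    rw [map_mul, map_mul, map_pow, map_pow, div_pow, div_mul_div_comm]
  obtain ⟨n, hn⟩ := Nat.exists_eq_succ_of_ne_zero hq.ne'
  have h2 : a ^ p ^ e * u * (b ^ p ^ e * v) ^ (p ^ e - 1) =
      (a * b ^ n) ^ p ^ e * (u * v ^ (p ^ e - 1)) := by
    rw [hn, Nat.succ_sub_one]
    ring
  have h3 : b ^ p ^ e * v = b ^ n * (b * v) := by
    rw [hn, pow_succ, mul_assoc]
  rw [h1, fractionFrobeniusTrace_div p e _ (mul_ne_zero (pow_ne_zero _ hb0) hv0), h2, h3,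
    frobeniusTrace_pow_mul, fractionFrobeniusTrace_div p e _ hv0]
  generalize frobeniusTrace p e (u * v ^ (p ^ e - 1)) = t
  rw [map_mul, map_mul, map_mul, map_mul, map_pow]
  field_simp

end FractionField

end

end MvPolynomial

/-! ### Fedder's criterion for products of powers of three linear forms. -/

namespace MvPolynomial

noncomputable section

variable {k : Type*} [Field k]

theorem mem_span_X_pow_iff {σ : Type*} {q : ℕ} {f : MvPolynomial σ k} :
    f ∈ Ideal.span (Set.range fun i : σ => (X i : MvPolynomial σ k) ^ q) ↔
      ∀ m ∈ f.support, ∃ i, q ≤ m i := by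
  have h := mem_ideal_span_monomial_image (x := f)
    (s := Set.range fun i : σ => Finsupp.single i q)
  rw [← Set.range_comp] at h
  simpa [Function.comp_def, ← X_pow_eq_monomial] using h

theorem IsHomogeneous.isFrobeniusCompatible_of_notMem_span {σ : Type*} [Fintype σ] {p e n : ℕ}
    [ExpChar k p] [PerfectRing k p] {F : MvPolynomial σ k} (hF : F.IsHomogeneous n)
    (h : F ∉ Ideal.span (Set.range fun i : σ => (X i : MvPolynomial σ k) ^ p ^ e)) :
    IsFrobeniusCompatible p e F := by
  rw [mem_span_X_pow_iff] at h
  push Not at h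
  obtain ⟨m, hm, hlt⟩ := h
  exact isFrobeniusCompatible_of_coeff_ne_zero hF (mem_support_iff.mp hm) hlt

/-- The linear form `v₀ x₀ + v₁ x₁`. -/
def linearForm (v : Fin 2 → k) : MvPolynomial (Fin 2) k := C (v 0) * X 0 + C (v 1) * X 1

theorem isHomogeneous_linearForm (v : Fin 2 → k) : (linearForm v).IsHomogeneous 1 :=
  ((isHomogeneous_C_mul_X _ _)).add (isHomogeneous_C_mul_X _ _)

theorem linearForm_pow (v : Fin 2 → k) (n : ℕ) :
    linearForm v ^ n = ∑ i ∈ Finset.range (n + 1),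
      monomial (Finsupp.single 0 i + Finsupp.single 1 (n - i))
        (v 0 ^ i * v 1 ^ (n - i) * (n.choose i : k)) := by
  rw [linearForm, add_pow]
  refine Finset.sum_congr rfl fun i _ => ?_
  rw [mul_pow, mul_pow, ← C_pow, ← C_pow, X_pow_eq_monomial, X_pow_eq_monomial, C_mul_monomial,
    C_mul_monomial, monomial_mul, ← C_eq_coe_nat, mul_comm _ (C _), C_mul_monomial]
  congr 1
  ring

theorem coeff_linearForm_pow (v : Fin 2 → k) {n i : ℕ} (hi : i ≤ n) :
    coeff (Finsupp.single 0 i + Finsupp.single 1 (n - i)) (linearForm v ^ n) =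
      v 0 ^ i * v 1 ^ (n - i) * (n.choose i : k) := by
  rw [linearForm_pow, coeff_sum, Finset.sum_eq_single i]
  · rw [coeff_monomial, if_pos rfl]
  · intro j _ hj
    rw [coeff_monomial, if_neg]
    intro h
    have := DFunLike.congr_fun h 0
    simp at this
    exact hj this
  · intro h
    simp at h
    omega

section

variable {p : ℕ} [CharP k p] [hp : Fact p.Prime]

theorem X_pow_mul_linearForm_pow_notMem_span {v : Fin 2 → k} (hv0 : v 0 ≠ 0) (hv1 : v 1 ≠ 0)
    {a b c : ℕ} (ha : a < p) (hb : b < p) (hc : c < p) (h : a + b + c ≤ 2 * (p - 1)) :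
    (X 0 ^ a * X 1 ^ b * linearForm v ^ c : MvPolynomial (Fin 2) k) ∉
      Ideal.span (Set.range fun i : Fin 2 => (X i : MvPolynomial (Fin 2) k) ^ p) := by
  rw [mem_span_X_pow_iff]
  push Not
  -- Give `x₀` as much of the exponent `c` as fits below `p`; the bound on `a + b + c` lets the rest
  -- fit into `x₁`.
  obtain ⟨i, hic, h0, h1⟩ : ∃ i ≤ c, a + i < p ∧ b + (c - i) < p :=
    ⟨min c (p - 1 - a), by omega, by omega, by omega⟩
  refine ⟨Finsupp.single 0 a + Finsupp.single 1 b +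
    (Finsupp.single 0 i + Finsupp.single 1 (c - i)), ?_, ?_⟩
  · rw [mem_support_iff, X_pow_eq_monomial, X_pow_eq_monomial, monomial_mul, coeff_monomial_mul,
      coeff_linearForm_pow v hic]
    have hch : (c.choose i : k) ≠ 0 := by
      rw [ne_eq, CharP.cast_eq_zero_iff k p]
      exact (Nat.Prime.coprime_iff_not_dvd hp.out).mp (hp.out.coprime_choose_of_lt hc hic)
    simp [hv0, hv1, hch]
  · intro j
    fin_cases j <;> simpa

/-- The determinant of two vectors of the plane. -/
def det₂ (v w : Fin 2 → k) : k := v 0 * w 1 - v 1 * w 0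

variable [PerfectRing k p]

/-- A linear change of coordinates takes `u, v` to `X 0, X 1`; the pairwise independence makes both
coefficients of the image of `w` nonzero. -/
theorem isFrobeniusCompatible_one {u v w : Fin 2 → k} (huv : det₂ u v ≠ 0) (huw : det₂ u w ≠ 0)
    (hvw : det₂ v w ≠ 0) {a b c : ℕ} (ha : a < p) (hb : b < p) (hc : c < p)
    (h : a + b + c ≤ 2 * (p - 1)) :
    IsFrobeniusCompatible p 1 (linearForm u ^ a * linearForm v ^ b * linearForm w ^ c) := by
  refine ((((isHomogeneous_linearForm u).pow a).mul ((isHomogeneous_linearForm v).pow b)).mul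
    ((isHomogeneous_linearForm w).pow c)).isFrobeniusCompatible_of_notMem_span fun hmem => ?_
  rw [pow_one] at hmem
  set D := det₂ u v with hD
  -- The inverse of the matrix with rows `u` and `v`.
  let s : Fin 2 → Fin 2 → k := ![![v 1 / D, - u 1 / D], ![- v 0 / D, u 0 / D]]
  let τ : MvPolynomial (Fin 2) k →ₐ[k] MvPolynomial (Fin 2) k := aeval fun i => linearForm (s i)
  have hτ (x : Fin 2 → k) : τ (linearForm x) =
      linearForm ![x 0 * s 0 0 + x 1 * s 1 0, x 0 * s 0 1 + x 1 * s 1 1] := by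
    simp only [linearForm, map_add, map_mul, τ, aeval_X, algHom_C, algebraMap_eq, Matrix.cons_val]
    ring
  have hu : τ (linearForm u) = X 0 := by
    rw [hτ]
    have h1 : u 0 * s 0 0 + u 1 * s 1 0 = 1 := by
      simp only [s, Matrix.cons_val]
      field_simp
      rw [hD, det₂]
      ring
    have h2 : u 0 * s 0 1 + u 1 * s 1 1 = 0 := by
      simp only [s, Matrix.cons_val]
      ring
    simp [linearForm, h1, h2]
  have hv : τ (linearForm v) = X 1 := by
    rw [hτ]
    have h1 : v 0 * s 0 0 + v 1 * s 1 0 = 0 := by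
      simp only [s, Matrix.cons_val]
      ring
    have h2 : v 0 * s 0 1 + v 1 * s 1 1 = 1 := by
      simp only [s, Matrix.cons_val]
      field_simp
      rw [hD, det₂]
      ring
    simp [linearForm, h1, h2]
  -- The ideal of `p`-th powers is stable under linear substitutions because Frobenius is additive.
  have hle : Ideal.span (Set.range fun i : Fin 2 => (X i : MvPolynomial (Fin 2) k) ^ p) ≤
      (Ideal.span (Set.range fun i : Fin 2 => (X i : MvPolynomial (Fin 2) k) ^ p)).comap τ := by
    rw [Ideal.span_le]
    rintro _ ⟨i, rfl⟩
    have h1 : τ (X i ^ p) = C (s i 0) ^ p * X 0 ^ p + C (s i 1) ^ p * X 1 ^ p := by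
      rw [map_pow, aeval_X, linearForm, add_pow_char, mul_pow, mul_pow]
    change τ (X i ^ p) ∈ Ideal.span _
    rw [h1]
    exact add_mem (Ideal.mul_mem_left _ _ (Ideal.subset_span ⟨0, rfl⟩))
      (Ideal.mul_mem_left _ _ (Ideal.subset_span ⟨1, rfl⟩))
  have hmem' := hle hmem
  rw [Ideal.mem_comap, map_mul, map_mul, map_pow, map_pow, map_pow, hu, hv, hτ] at hmem'
  refine X_pow_mul_linearForm_pow_notMem_span ?_ ?_ ha hb hc h hmem'
  · have : w 0 * s 0 0 + w 1 * s 1 0 = - det₂ v w / D := by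
      simp only [s, Matrix.cons_val, det₂]
      ring
    simpa [this, huv] using hvw
  · have : w 0 * s 0 1 + w 1 * s 1 1 = det₂ u w / D := by
      simp only [s, Matrix.cons_val, det₂]
      ring
    simpa [this, huv] using huw

end

end

/-! ### Rounding up to fractions with small digit sums in base `p`. -/

/-- Triples of integers with `e` digits in base `p`, such that in each place the three digits add up
to at most `2 (p - 1)`. -/
inductive HasSmallDigitSums (p : ℕ) : ℕ → ℕ → ℕ → ℕ → Prop
  | zero : HasSmallDigitSums p 0 0 0 0
  | step {e a b c a' b' c' : ℕ} (h : HasSmallDigitSums p e a b c) (ha : a' < p) (hb : b' < p)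
      (hc : c' < p) (hs : a' + b' + c' ≤ 2 * (p - 1)) :
      HasSmallDigitSums p (e + 1) (a' * p ^ e + a) (b' * p ^ e + b) (c' * p ^ e + c)

/-- `HasSmallDigitSums.step` adds a leading digit, which matches `F ^ p ^ e * H` with `F` carrying
that digit. -/
theorem HasSmallDigitSums.isFrobeniusCompatible {k : Type*} [Field k] {p : ℕ} [CharP k p]
    [hp : Fact p.Prime] [PerfectRing k p] {u v w : Fin 2 → k} (huv : det₂ u v ≠ 0)
    (huw : det₂ u w ≠ 0) (hvw : det₂ v w ≠ 0) {e a b c : ℕ} (h : HasSmallDigitSums p e a b c) :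
    IsFrobeniusCompatible p e (linearForm u ^ a * linearForm v ^ b * linearForm w ^ c) := by
  induction h with
  | zero => simpa using isFrobeniusCompatible_zero_one
  | step _ ha hb hc hs ih =>
    convert! (isFrobeniusCompatible_one huv huw hvw ha hb hc hs).pow_mul ih using 1
    · exact add_comm _ _
    · ring

theorem HasSmallDigitSums.single {p a b c : ℕ} (ha : a < p) (hb : b < p)
    (hc : c < p) (hs : a + b + c ≤ 2 * (p - 1)) : HasSmallDigitSums p 1 a b c := by
  simpa using HasSmallDigitSums.step .zero ha hb hc hs

/-- The function that decides whether `r₁ / N`, `r₂ / N`, `r₃ / N` can be rounded up to fractions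
with denominator `p ^ e` whose numerators have small digit sums. -/
def roundsUp (p N : ℕ) : ℕ → ℕ → ℕ → ℕ → Bool
  | 0, r₁, r₂, r₃ => r₁ == 0 && (r₂ == 0 && r₃ == 0)
  | e + 1, r₁, r₂, r₃ =>
    [(p * r₁ / N, p * r₁ % N), (p * r₁ / N + 1, 0)].any fun x =>
      [(p * r₂ / N, p * r₂ % N), (p * r₂ / N + 1, 0)].any fun y =>
        [(p * r₃ / N, p * r₃ % N), (p * r₃ / N + 1, 0)].any fun z =>
          Nat.blt x.1 p && (Nat.blt y.1 p && (Nat.blt z.1 p &&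
            (Nat.ble (x.1 + y.1 + z.1) (2 * (p - 1)) && roundsUp p N e x.2 y.2 z.2)))

/-- At each place the digit is either the exact one, with the remainder carried on, or one more,
after which nothing remains to be covered. In both cases `p * r ≤ N * x + y`, and this inequality
propagates through the digits. -/
theorem exists_hasSmallDigitSums_of_roundsUp {p N : ℕ} (hN : 0 < N) {e r₁ r₂ r₃ : ℕ}
    (h : roundsUp p N e r₁ r₂ r₃ = true) : ∃ a b c, HasSmallDigitSums p e a b c ∧
      r₁ * p ^ e ≤ N * a ∧ r₂ * p ^ e ≤ N * b ∧ r₃ * p ^ e ≤ N * c := by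
  have key (r e x y a : ℕ)
      (hx : (x, y) = (p * r / N, p * r % N) ∨ (x, y) = (p * r / N + 1, 0)) (ha : y * p ^ e ≤ N * a) :
      r * p ^ (e + 1) ≤ N * (x * p ^ e + a) := by
    have h1 : p * r ≤ N * x + y := by
      rcases hx with hx | hx <;> obtain ⟨rfl, rfl⟩ := Prod.mk.inj hx
      · exact (Nat.div_add_mod _ _).ge
      · have := Nat.div_add_mod (p * r) N
        have := Nat.mod_lt (p * r) hN
        rw [mul_add]
        omega
    calc r * p ^ (e + 1) = p * r * p ^ e := by ring
      _ ≤ (N * x + y) * p ^ e := Nat.mul_le_mul_right _ h1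
      _ = N * x * p ^ e + y * p ^ e := add_mul _ _ _
      _ ≤ N * x * p ^ e + N * a := Nat.add_le_add_left ha _
      _ = _ := by ring
  induction e generalizing r₁ r₂ r₃ with
  | zero =>
    simp only [roundsUp, Bool.and_eq_true, beq_iff_eq] at h
    obtain ⟨rfl, rfl, rfl⟩ := h
    exact ⟨0, 0, 0, .zero, by simp⟩
  | succ e ih =>
    simp only [roundsUp, List.any_eq_true, Bool.and_eq_true, Nat.blt_eq, Nat.ble_eq,
      List.mem_cons, List.not_mem_nil, or_false] at h
    obtain ⟨⟨x₁, y₁⟩, hx₁, ⟨x₂, y₂⟩, hx₂, ⟨x₃, y₃⟩, hx₃, h₁, h₂, h₃, hs, hr⟩ := h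
    obtain ⟨a, b, c, hd, ha, hb, hc⟩ := ih hr
    exact ⟨_, _, _, hd.step h₁ h₂ h₃ hs, key _ _ _ _ _ hx₁ ha, key _ _ _ _ _ hx₂ hb,
      key _ _ _ _ _ hx₃ hc⟩

/-- Over the common denominator `60` the triples are `(1/2, 2/3, 4/5)`, `(2/5, 2/3, 5/6)` and `(1/3,
3/4, 3/4)`. Three digits suffice for every `p` in this range prime to `30`, whether or not it is
prime. -/
theorem roundsUp_of_lt : ∀ p : ℕ, p < 120 → 5 < p → p % 2 ≠ 0 → p % 3 ≠ 0 → p % 5 ≠ 0 →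
    (roundsUp p 60 3 30 40 48 && (roundsUp p 60 3 24 40 50 && roundsUp p 60 3 20 45 45)) = true := by
  decide

section

variable {p : ℕ} [hp : Fact p.Prime]

theorem not_dvd_of_prime_of_lt (h5 : 5 < p) : p % 2 ≠ 0 ∧ p % 3 ≠ 0 ∧ p % 5 ≠ 0 := by
  refine ⟨?_, ?_, ?_⟩ <;> intro h <;>
    have := (Nat.prime_dvd_prime_iff_eq (by norm_num) hp.out).mp (Nat.dvd_of_mod_eq_zero h) <;>
    omega

theorem exists_hasSmallDigitSums_two_three_five (h5 : 5 < p) : ∃ e a b c, 0 < e ∧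
    HasSmallDigitSums p e a b c ∧ p ^ e ≤ 2 * a ∧ 2 * p ^ e ≤ 3 * b ∧ 4 * p ^ e ≤ 5 * c := by
  obtain ⟨h2, h3, h5'⟩ := not_dvd_of_prime_of_lt h5
  by_cases hlt : p < 120
  · have h := roundsUp_of_lt p hlt h5 h2 h3 h5'
    simp only [Bool.and_eq_true] at h
    obtain ⟨a, b, c, h, ha, hb, hc⟩ := exists_hasSmallDigitSums_of_roundsUp (by norm_num) h.1
    exact ⟨3, a, b, c, by norm_num, h, by omega, by omega, by omega⟩
  -- The digits are the fractions of `p` rounded up. Their sum is at most `59 (p + 1) / 30`, which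
  -- is at most `2 (p - 1)` exactly when `p ≥ 119`; this triple sets the threshold for all three.
  · exact ⟨1, (p + 1) / 2, (2 * p + 2) / 3, (4 * p + 4) / 5, one_pos,
      .single (by omega) (by omega) (by omega) (by omega), by rw [pow_one]; omega, by rw [pow_one]; omega,
      by rw [pow_one]; omega⟩

theorem exists_hasSmallDigitSums_two_fifths (h5 : 5 < p) : ∃ e a b c, 0 < e ∧
    HasSmallDigitSums p e a b c ∧ 2 * p ^ e ≤ 5 * a ∧ 2 * p ^ e ≤ 3 * b ∧ 5 * p ^ e ≤ 6 * c := by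
  obtain ⟨h2, h3, h5'⟩ := not_dvd_of_prime_of_lt h5
  by_cases hlt : p < 120
  · have h := roundsUp_of_lt p hlt h5 h2 h3 h5'
    simp only [Bool.and_eq_true] at h
    obtain ⟨a, b, c, h, ha, hb, hc⟩ := exists_hasSmallDigitSums_of_roundsUp (by norm_num) h.2.1
    exact ⟨3, a, b, c, by norm_num, h, by omega, by omega, by omega⟩
  · exact ⟨1, (2 * p + 4) / 5, (2 * p + 2) / 3, (5 * p + 5) / 6, one_pos,
      .single (by omega) (by omega) (by omega) (by omega), by rw [pow_one]; omega, by rw [pow_one]; omega,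
      by rw [pow_one]; omega⟩

theorem exists_hasSmallDigitSums_one_third (h5 : 5 < p) : ∃ e a b c, 0 < e ∧
    HasSmallDigitSums p e a b c ∧ p ^ e ≤ 3 * a ∧ 3 * p ^ e ≤ 4 * b ∧ 3 * p ^ e ≤ 4 * c := by
  obtain ⟨h2, h3, h5'⟩ := not_dvd_of_prime_of_lt h5
  by_cases hlt : p < 120
  · have h := roundsUp_of_lt p hlt h5 h2 h3 h5'
    simp only [Bool.and_eq_true] at h
    obtain ⟨a, b, c, h, ha, hb, hc⟩ := exists_hasSmallDigitSums_of_roundsUp (by norm_num) h.2.2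
    exact ⟨3, a, b, c, by norm_num, h, by omega, by omega, by omega⟩
  · exact ⟨1, (p + 2) / 3, (3 * p + 3) / 4, (3 * p + 3) / 4, one_pos,
      .single (by omega) (by omega) (by omega) (by omega), by rw [pow_one]; omega, by rw [pow_one]; omega,
      by rw [pow_one]; omega⟩

theorem exists_hasSmallDigitSums_two_two (h5 : 5 < p) (e : ℕ) : ∃ a c,
    HasSmallDigitSums p (e + 1) a a c ∧ p ^ (e + 1) ≤ 2 * a ∧ p ^ (e + 1) ≤ c + p := by
  obtain ⟨h2, -, -⟩ := not_dvd_of_prime_of_lt h5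
  induction e with
  | zero =>
    -- The last place is special: rounding `1/2` up costs `(p + 1) / 2` twice, so the third digit is
    -- given up. All higher places are `(p - 1) / 2, (p - 1) / 2, p - 1`, with sum exactly `2 (p -
    -- 1)`. The third number thus falls short of `p ^ (e + 1)` by only `p`.
    exact ⟨(p + 1) / 2, 0, .single (by omega) (by omega) (by omega) (by omega),
      by rw [zero_add, pow_one]; omega, by rw [zero_add, pow_one]; omega⟩
  | succ e ih =>
    obtain ⟨a, c, h, ha, hc⟩ := ih
    refine ⟨_, _, h.step (a' := (p - 1) / 2) (b' := (p - 1) / 2) (c' := p - 1) (by omega)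
      (by omega) (by omega) (by omega), ?_, ?_⟩
    · obtain ⟨n, rfl⟩ : ∃ n, p = 2 * n + 1 := ⟨p / 2, by omega⟩
      have : (2 * n + 1 - 1) / 2 = n := by omega
      rw [this, pow_succ _ (e + 1)]
      nlinarith
    · obtain ⟨n, rfl⟩ : ∃ n, p = n + 1 := ⟨p - 1, by omega⟩
      rw [Nat.add_sub_cancel, pow_succ _ (e + 1)]
      nlinarith

theorem exists_hasSmallDigitSums_two (e : ℕ) : ∃ a, HasSmallDigitSums p e a a 0 ∧
    p ^ e ≤ a + 1 := by
  have h1 := hp.out.one_lt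
  induction e with
  | zero => exact ⟨0, .zero, by simp⟩
  | succ e ih =>
    obtain ⟨a, h, ha⟩ := ih
    refine ⟨(p - 1) * p ^ e + a, ?_, ?_⟩
    · simpa using h.step (a' := p - 1) (b' := p - 1) (c' := 0) (by omega) (by omega) (by omega)
        (by omega)
    · obtain ⟨n, rfl⟩ : ∃ n, p = n + 1 := ⟨p - 1, by omega⟩
      rw [Nat.add_sub_cancel, pow_succ]
      nlinarith

end

end MvPolynomial

/-! ### Sections on `Proj` of a graded domain as elements of its field of fractions. -/

namespace AlgebraicGeometry.Proj

noncomputable section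

open ProjectiveSpectrum.StructureSheaf HomogeneousLocalization

variable {A : Type u} [CommRing A] [IsDomain A] {σ : Type*} [SetLike σ A] [AddSubgroupClass σ A]
  (𝒜 : ℕ → σ) [GradedRing 𝒜]

/-- The embedding of a homogeneous localization of a graded domain into its field of fractions. -/
def localizationToFractionRing (x : ProjectiveSpectrum 𝒜) :
    HomogeneousLocalization.AtPrime 𝒜 x.asHomogeneousIdeal.toIdeal →+* FractionRing A :=
  (IsLocalization.lift (M := x.asHomogeneousIdeal.toIdeal.primeCompl)
    (S := Localization.AtPrime x.asHomogeneousIdeal.toIdeal) (g := algebraMap A (FractionRing A))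
    fun s => IsUnit.mk0 _ fun h => s.2 (by
      rw [map_eq_zero_iff _ (IsFractionRing.injective A _)] at h
      rw [h]
      exact Ideal.zero_mem _)).comp
    (algebraMap (HomogeneousLocalization.AtPrime 𝒜 x.asHomogeneousIdeal.toIdeal) _)

theorem localizationToFractionRing_mk (x : ProjectiveSpectrum 𝒜)
    (f : NumDenSameDeg 𝒜 x.asHomogeneousIdeal.toIdeal.primeCompl) :
    localizationToFractionRing 𝒜 x (.mk f) =
      algebraMap A (FractionRing A) f.num / algebraMap A (FractionRing A) f.den := by
  rw [localizationToFractionRing, RingHom.comp_apply, HomogeneousLocalization.algebraMap_apply, val_mk,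
    Localization.mk_eq_mk', IsLocalization.lift_mk'_spec, mul_div_cancel₀]
  intro h
  rw [map_eq_zero_iff _ (IsFractionRing.injective A _)] at h
  exact f.den_mem (h ▸ Ideal.zero_mem _)

theorem localizationToFractionRing_injective (x : ProjectiveSpectrum 𝒜) :
    Function.Injective (localizationToFractionRing 𝒜 x) := by
  rw [injective_iff_map_eq_zero]
  intro z hz
  obtain ⟨f, rfl⟩ := mk_surjective z
  rw [localizationToFractionRing_mk, div_eq_zero_iff,
    map_eq_zero_iff _ (IsFractionRing.injective A _),
    map_eq_zero_iff _ (IsFractionRing.injective A _)] at hz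
  rcases hz with hz | hz
  · exact mk_eq_zero_of_num _ (Subtype.ext hz)
  · exact absurd (hz ▸ Ideal.zero_mem _) f.den_mem

/-- The embedding of a stalk of the projective spectrum of a graded domain into the field of
fractions of the domain. -/
def stalkToFractionRing (x : Proj 𝒜) : (Proj 𝒜).presheaf.stalk x →+* FractionRing A :=
  (localizationToFractionRing 𝒜 x).comp (stalkIso 𝒜 x).hom.hom

theorem stalkToFractionRing_injective (x : Proj 𝒜) :
    Function.Injective (stalkToFractionRing 𝒜 x) :=
  (localizationToFractionRing_injective 𝒜 x).comp
    (stalkIso 𝒜 x).commRingCatIsoToRingEquiv.injective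

theorem stalkToFractionRing_germ (U : (Proj 𝒜).Opens) (x : Proj 𝒜) (hx : x ∈ U)
    (s : Γ(Proj 𝒜, U)) : stalkToFractionRing 𝒜 x ((Proj 𝒜).presheaf.germ U x hx s) =
      localizationToFractionRing 𝒜 x (s.1 ⟨x, hx⟩) :=
  congrArg (localizationToFractionRing 𝒜 x) (stalkIso'_germ 𝒜 U x hx s)

theorem exists_section_of_fraction (x : Proj 𝒜) {n : ℕ} {a b : A} (ha : a ∈ 𝒜 n) (hb : b ∈ 𝒜 n)
    (hbx : x ∈ basicOpen 𝒜 b) :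
    ∃ s : Γ(Proj 𝒜, basicOpen 𝒜 b), ∀ (y : Proj 𝒜) (hy : y ∈ basicOpen 𝒜 b),
      stalkToFractionRing 𝒜 y ((Proj 𝒜).presheaf.germ _ y hy s) =
        algebraMap A (FractionRing A) a / algebraMap A (FractionRing A) b := by
  refine ⟨sectionInBasicOpen 𝒜 x ⟨n, ⟨a, ha⟩, ⟨b, hb⟩, hbx⟩, fun y hy => ?_⟩
  refine (stalkToFractionRing_germ 𝒜 _ y hy _).trans ?_
  exact localizationToFractionRing_mk 𝒜 y ⟨n, ⟨a, ha⟩, ⟨b, hb⟩, hy⟩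

theorem mem_range_stalkToFractionRing_iff (x : Proj 𝒜) (f : FractionRing A) :
    f ∈ (stalkToFractionRing 𝒜 x).range ↔ ∃ (n : ℕ) (a b : A), a ∈ 𝒜 n ∧ b ∈ 𝒜 n ∧
      x ∈ basicOpen 𝒜 b ∧
      algebraMap A (FractionRing A) a / algebraMap A (FractionRing A) b = f := by
  constructor
  · rintro ⟨z, rfl⟩
    obtain ⟨f, hf⟩ := mk_surjective (stalkIso' 𝒜 x z)
    refine ⟨f.deg, f.num, f.den, f.num.2, f.den.2, f.den_mem, ?_⟩
    exact (localizationToFractionRing_mk 𝒜 x f).symm.trans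
      (congrArg (localizationToFractionRing 𝒜 x) hf)
  · rintro ⟨n, a, b, ha, hb, hbx, rfl⟩
    obtain ⟨s, hs⟩ := exists_section_of_fraction 𝒜 x ha hb hbx
    exact ⟨_, hs x hbx⟩

/-- Both sides are a fraction `a / b` representing `z` on a neighbourhood of `x`, and such a
neighbourhood contains the generization `y`. -/
theorem stalkToFractionRing_stalkSpecializes {x y : Proj 𝒜} (h : y ⤳ x)
    (z : (Proj 𝒜).presheaf.stalk x) :
    stalkToFractionRing 𝒜 y ((Proj 𝒜).presheaf.stalkSpecializes h z) =
      stalkToFractionRing 𝒜 x z := by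
  obtain ⟨n, a, b, ha, hb, hbx, he⟩ := (mem_range_stalkToFractionRing_iff 𝒜 x _).mp ⟨z, rfl⟩
  obtain ⟨s, hs⟩ := exists_section_of_fraction 𝒜 x ha hb hbx
  have hz : (Proj 𝒜).presheaf.germ _ x hbx s = z :=
    stalkToFractionRing_injective 𝒜 x ((hs x hbx).trans he)
  have hy : y ∈ basicOpen 𝒜 b := h.mem_open (basicOpen 𝒜 b).isOpen hbx
  rw [← hz, TopCat.Presheaf.germ_stalkSpecializes_apply, hs x hbx, hs y hy]

/-- Sections over an open set of the projective spectrum of a graded domain are those elements of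
the field of fractions that belong to all stalks. -/
theorem exists_section_of_forall_mem_range {U : (Proj 𝒜).Opens} {f : FractionRing A}
    (hf : ∀ x ∈ U, f ∈ (stalkToFractionRing 𝒜 x).range) :
    ∃ s : Γ(Proj 𝒜, U), ∀ (x : Proj 𝒜) (hx : x ∈ U),
      stalkToFractionRing 𝒜 x ((Proj 𝒜).presheaf.germ U x hx s) = f := by
  have hf' (x : ProjectiveSpectrum 𝒜) (hx : (show Proj 𝒜 from x) ∈ U) :
      ∃ z : HomogeneousLocalization.AtPrime 𝒜 x.asHomogeneousIdeal.toIdeal,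
        localizationToFractionRing 𝒜 x z = f :=
    let ⟨z, hz⟩ := hf x hx
    ⟨stalkIso' 𝒜 x z, hz⟩
  choose g hg using hf'
  refine ⟨⟨fun x => g x.1 x.2, fun x => ?_⟩, fun x hx => ?_⟩
  · obtain ⟨n, a, b, ha, hb, hbx, he⟩ := (mem_range_stalkToFractionRing_iff 𝒜 x.1 _).mp
      (hf x.1 x.2)
    refine ⟨U ⊓ basicOpen 𝒜 b, ⟨x.2, hbx⟩, homOfLE inf_le_left, n, ⟨a, ha⟩, ⟨b, hb⟩,
      fun y => y.2.2, fun y => ?_⟩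
    refine localizationToFractionRing_injective 𝒜 y.1 ?_
    exact (hg _ _).trans (he.symm.trans (localizationToFractionRing_mk 𝒜 y.1
      ⟨n, ⟨a, ha⟩, ⟨b, hb⟩, y.2.2⟩).symm)
  · exact (stalkToFractionRing_germ 𝒜 U x hx _).trans (hg _ _)

end

end AlgebraicGeometry.Proj

/-! ### Linear forms and the points of the projective line. -/

namespace MvPolynomial

section

variable {k : Type*} [Field k]

theorem eval_linearForm (v a : Fin 2 → k) : eval a (linearForm v) = v 0 * a 0 + v 1 * a 1 := by
  simp [linearForm]

theorem linearForm_ne_zero {v : Fin 2 → k} (hv : v ≠ 0) : linearForm v ≠ 0 := by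
  contrapose! hv
  have h (a : Fin 2 → k) : v 0 * a 0 + v 1 * a 1 = 0 := by rw [← eval_linearForm, hv, map_zero]
  ext i
  fin_cases i
  · simpa using h ![1, 0]
  · simpa using h ![0, 1]

theorem exists_linearForm_eq_C_mul {v w : Fin 2 → k} (hw : w ≠ 0) (h : det₂ v w = 0) :
    ∃ c, linearForm v = C c * linearForm w := by
  have h' : v 0 * w 1 = v 1 * w 0 := sub_eq_zero.mp h
  obtain ⟨i, hi⟩ := Function.ne_iff.mp hw
  rw [Pi.zero_apply] at hi
  have hj (j : Fin 2) : v j = v i / w i * w j := by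
    field_simp
    fin_cases i <;> fin_cases j <;> first | rfl | exact h' | exact h'.symm
  refine ⟨v i / w i, ?_⟩
  rw [linearForm, linearForm, mul_add, ← mul_assoc, ← mul_assoc, ← map_mul, ← map_mul, ← hj, ← hj]

theorem span_linearForm_eq {v w : Fin 2 → k} (hv : v ≠ 0) (hw : w ≠ 0) (h : det₂ v w = 0) :
    Ideal.span {linearForm v} = Ideal.span {linearForm w} := by
  have h' : det₂ w v = 0 := by
    rw [det₂] at h ⊢
    linear_combination -h
  obtain ⟨c, hc⟩ := exists_linearForm_eq_C_mul hw h
  obtain ⟨d, hd⟩ := exists_linearForm_eq_C_mul hv h'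
  exact le_antisymm (Ideal.span_singleton_le_span_singleton.mpr ⟨_, hc.trans (mul_comm _ _)⟩)
    (Ideal.span_singleton_le_span_singleton.mpr ⟨_, hd.trans (mul_comm _ _)⟩)

theorem det₂_eq_zero_of_dvd {v w : Fin 2 → k} (h : linearForm w ∣ linearForm v) :
    det₂ v w = 0 := by
  obtain ⟨g, hg⟩ := h
  have := congrArg (eval ![w 1, - w 0]) hg
  simp only [eval_linearForm, map_mul, Matrix.cons_val] at this
  rw [det₂]
  linear_combination this

theorem not_isUnit_linearForm (v : Fin 2 → k) : ¬ IsUnit (linearForm v) := by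
  intro h
  have := h.map (eval (0 : Fin 2 → k))
  rw [eval_linearForm] at this
  simp at this

end

/-- Choose a linear form `u` with `u(a) = 1`. Modulo `a₁ x₀ - a₀ x₁` one has `x_i = a_i u`, so by
homogeneity `f` becomes `u ^ n f(a) = 0`. -/
theorem linearForm_dvd_of_isHomogeneous {k : Type u} [Field k] {a : Fin 2 → k} (ha : a ≠ 0)
    {f : MvPolynomial (Fin 2) k} {n : ℕ} (hf : f.IsHomogeneous n) (h : eval a f = 0) :
    linearForm ![a 1, - a 0] ∣ f := by
  obtain ⟨u, hu⟩ : ∃ u : Fin 2 → k, u 0 * a 0 + u 1 * a 1 = 1 := by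
    obtain ⟨i, hi⟩ := Function.ne_iff.mp ha
    rw [Pi.zero_apply] at hi
    fin_cases i
    · exact ⟨![(a 0)⁻¹, 0], by simpa using inv_mul_cancel₀ hi⟩
    · exact ⟨![0, (a 1)⁻¹], by simpa using inv_mul_cancel₀ hi⟩
  rw [← Ideal.mem_span_singleton, ← Ideal.Quotient.eq_zero_iff_mem]
  set I := Ideal.span {linearForm ![a 1, - a 0]}
  have hX (i : Fin 2) : Ideal.Quotient.mk I (X i) =
      Ideal.Quotient.mk I (linearForm u) * Ideal.Quotient.mk I (C (a i)) := by
    rw [← map_mul, Ideal.Quotient.eq, Ideal.mem_span_singleton]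
    have hC : C (u 0) * C (a 0) + C (u 1) * C (a 1) = (1 : MvPolynomial (Fin 2) k) := by
      rw [← C_mul, ← C_mul, ← C_add, hu, C_1]
    fin_cases i
    · refine ⟨C (u 1), ?_⟩
      simp only [linearForm, Matrix.cons_val, C_neg, Fin.zero_eta]
      linear_combination -(X 0) * hC
    · refine ⟨- C (u 0), ?_⟩
      simp only [linearForm, Matrix.cons_val, C_neg, Fin.mk_one]
      linear_combination -(X 1) * hC
  have h1 := ProjectiveLine.eval₂_mul_of_isHomogeneous k
    ((Ideal.Quotient.mk I).comp C) (Ideal.Quotient.mk I (linearForm u))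
    (fun i => Ideal.Quotient.mk I (C (a i))) hf
  have h2 : f.eval₂ ((Ideal.Quotient.mk I).comp C) (fun i => Ideal.Quotient.mk I (C (a i))) =
      Ideal.Quotient.mk I (C (eval a f)) :=
    (eval₂_comp_left ((Ideal.Quotient.mk I).comp C) (RingHom.id k) a f).symm
  have h3 := eval₂_comp_left (Ideal.Quotient.mk I) C X f
  rw [eval₂_eta] at h3
  rw [h3]
  have h4 : (Ideal.Quotient.mk I ∘ X : Fin 2 → _) = fun i =>
      Ideal.Quotient.mk I (linearForm u) * Ideal.Quotient.mk I (C (a i)) := _root_.funext hX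
  rw [h4, h1, h2, h, map_zero, map_zero, mul_zero]

end MvPolynomial

attribute [local instance] MvPolynomial.gradedAlgebra

namespace ProjectiveLine

open MvPolynomial

variable {k : Type u} [Field k]

local notation "𝒜" => MvPolynomial.homogeneousSubmodule (Fin 2) k

theorem exists_X_notMem (x : ProjectiveSpectrum 𝒜) :
    ∃ i : Fin 2, (X i : MvPolynomial (Fin 2) k) ∉ x.asHomogeneousIdeal :=
  TopologicalSpace.Opens.mem_iSup.mp ((iSup_basicOpen_eq_top k).ge (Set.mem_univ x))

theorem exists_eq_span_linearForm [IsAlgClosed k] (x : ProjectiveSpectrum 𝒜)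
    (hx : x.asHomogeneousIdeal.toIdeal ≠ ⊥) :
    ∃ v : Fin 2 → k, v ≠ 0 ∧ x.asHomogeneousIdeal.toIdeal = Ideal.span {linearForm v} := by
  have hP := x.isPrime
  -- By the Nullstellensatz, if the origin were the only possible zero, the prime ideal would
  -- contain both variables.
  obtain ⟨a, ha, ha0⟩ : ∃ a ∈ zeroLocus k x.asHomogeneousIdeal.toIdeal, a ≠ 0 := by
    by_contra! h
    obtain ⟨i, hi⟩ := exists_X_notMem x
    refine hi ?_
    rw [← HomogeneousIdeal.mem_iff, ← IsPrime.vanishingIdeal_zeroLocus (K := k)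
      x.asHomogeneousIdeal.toIdeal]
    intro a ha
    rw [h a ha]
    simp
  have hv : ![a 1, - a 0] ≠ 0 := by
    contrapose! ha0
    have h0 := congrFun ha0 0
    have h1 := congrFun ha0 1
    ext i
    fin_cases i
    · simpa using h1
    · simpa using h0
  have hle : x.asHomogeneousIdeal.toIdeal ≤ Ideal.span {linearForm ![a 1, - a 0]} := by
    intro f hf
    rw [← sum_homogeneousComponent f]
    refine Ideal.sum_mem _ fun n _ => Ideal.mem_span_singleton.mpr
      (linearForm_dvd_of_isHomogeneous ha0 (homogeneousComponent_isHomogeneous n f) ?_)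
    have h1 := (mem_iff_homogeneousComponent_mem x.asHomogeneousIdeal.isHomogeneous f).mp hf n
    simpa [aeval_eq_eval] using ha _ h1
  refine ⟨_, hv, le_antisymm hle ?_⟩
  rw [Ideal.span_singleton_le_iff_mem]
  obtain ⟨f, hf, hf0⟩ := Submodule.exists_mem_ne_zero_of_ne_bot hx
  -- Split off the largest power of the linear form from a nonzero `f` in the ideal. The cofactor is
  -- not in the ideal, so the linear form is.
  obtain ⟨g, hg, hndvd⟩ := (FiniteMultiplicity.of_not_isUnit
    (not_isUnit_linearForm ![a 1, - a 0]) hf0).exists_eq_pow_mul_and_not_dvd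
  rw [hg] at hf
  exact hP.mem_of_pow_mem _ ((hP.mem_or_mem hf).resolve_right fun h =>
    hndvd (Ideal.mem_span_singleton.mp (hle h)))

theorem eq_span_linearForm_of_mem [IsAlgClosed k] {x : ProjectiveSpectrum 𝒜} {v : Fin 2 → k}
    (hv : v ≠ 0) (h : linearForm v ∈ x.asHomogeneousIdeal) :
    x.asHomogeneousIdeal.toIdeal = Ideal.span {linearForm v} := by
  obtain ⟨w, hw, hxw⟩ := exists_eq_span_linearForm x fun hx => by
    rw [← HomogeneousIdeal.mem_iff, hx] at h
    exact linearForm_ne_zero hv h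
  rw [← HomogeneousIdeal.mem_iff, hxw, Ideal.mem_span_singleton] at h
  rw [hxw, span_linearForm_eq hv hw (det₂_eq_zero_of_dvd h)]

theorem specializes_iff (x y : ProjectiveLine k) :
    y ⤳ x ↔ y.asHomogeneousIdeal ≤ x.asHomogeneousIdeal :=
  specializes_iff_mem_closure.trans (ProjectiveSpectrum.le_iff_mem_closure 𝒜 y x).symm

theorem exists_asHomogeneousIdeal_eq {I : HomogeneousIdeal 𝒜} (hI : I.toIdeal.IsPrime) {i : Fin 2}
    (hi : (X i : MvPolynomial (Fin 2) k) ∉ I) :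
    ∃ x : ProjectiveLine k, x.asHomogeneousIdeal = I :=
  ⟨{ asHomogeneousIdeal := I
     isPrime := hI
     not_irrelevant_le := fun h => hi (h ((HomogeneousIdeal.mem_irrelevant_iff _ _).mpr (by
      rw [GradedRing.proj_apply]
      exact DirectSum.decompose_of_mem_ne 𝒜 (X_mem k i) one_ne_zero))) }, rfl⟩

variable (k) in
theorem exists_asHomogeneousIdeal_eq_bot : ∃ x : ProjectiveLine k, x.asHomogeneousIdeal = ⊥ :=
  exists_asHomogeneousIdeal_eq (by rw [HomogeneousIdeal.toIdeal_bot]; exact Ideal.isPrime_bot)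
    (i := 0) fun h => X_ne_zero 0 h

theorem asHomogeneousIdeal_ne_bot_of_isClosed {x : ProjectiveLine k} (hx : IsClosed {x}) :
    x.asHomogeneousIdeal ≠ ⊥ := by
  intro h
  let I : HomogeneousIdeal 𝒜 := ⟨Ideal.span {X 0}, Ideal.homogeneous_span 𝒜 _ (by
    rintro _ rfl
    exact ⟨1, X_mem k 0⟩)⟩
  obtain ⟨y, hy⟩ := exists_asHomogeneousIdeal_eq (I := I) (i := 1)
    ((Ideal.span_singleton_prime (X_ne_zero 0)).mpr X_prime) fun hmem => by
      obtain ⟨g, hg⟩ := Ideal.mem_span_singleton.mp hmem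
      have := congrArg (eval ![0, 1]) hg
      simp at this
  have hxy : x ⤳ y := (specializes_iff y x).mpr (h ▸ bot_le)
  have hyx : y = x := by
    have := hxy.mem_closed hx rfl
    exact this
  have hX : (X 0 : MvPolynomial (Fin 2) k) ∈ I := Ideal.mem_span_singleton_self _
  rw [← hy, hyx, h] at hX
  exact X_ne_zero 0 hX

theorem isMax_iff (x : ProjectiveLine k) : IsMax x ↔ x.asHomogeneousIdeal = ⊥ := by
  constructor
  · intro h
    obtain ⟨y, hy⟩ := exists_asHomogeneousIdeal_eq_bot k
    have hyx : y ⤳ x := (specializes_iff x y).mpr (hy ▸ bot_le)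
    have h1 := (specializes_iff y x).mp (Scheme.le_iff_specializes.mp
      (h (Scheme.le_iff_specializes.mpr hyx)))
    exact le_bot_iff.mp (h1.trans hy.le)
  · intro h y _
    exact Scheme.le_iff_specializes.mpr ((specializes_iff y x).mpr (h ▸ bot_le))

theorem toIdeal_eq_bot_iff (I : HomogeneousIdeal 𝒜) : I.toIdeal = ⊥ ↔ I = ⊥ := by
  refine ⟨fun h => HomogeneousIdeal.toIdeal_injective ?_, fun h => ?_⟩
  · rw [h, HomogeneousIdeal.toIdeal_bot]
  · rw [h, HomogeneousIdeal.toIdeal_bot]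

theorem coheight_eq_one_iff [IsAlgClosed k] (x : ProjectiveLine k) :
    Order.coheight x = 1 ↔ x.asHomogeneousIdeal ≠ ⊥ := by
  constructor
  · intro h
    rw [ne_eq, ← isMax_iff, ← Order.coheight_eq_zero, h]
    exact one_ne_zero
  · intro h
    refine le_antisymm ?_ (Order.one_le_iff_ne_zero.mpr ?_)
    · refine (Order.coheight_le_coe_iff (n := 1)).mpr fun y hy => ?_
      rw [Nat.cast_one, Order.lt_one_iff, Order.coheight_eq_zero, isMax_iff]
      by_contra hyb
      obtain ⟨v, hv, hyv⟩ := exists_eq_span_linearForm y (mt (toIdeal_eq_bot_iff _).mp hyb)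
      have h1 := (specializes_iff x y).mp (Scheme.le_iff_specializes.mp hy.le)
      have h2 : linearForm v ∈ y.asHomogeneousIdeal.toIdeal :=
        hyv ▸ Ideal.mem_span_singleton_self _
      have h3 := eq_span_linearForm_of_mem hv (h1 h2)
      have h4 : x.asHomogeneousIdeal = y.asHomogeneousIdeal :=
        HomogeneousIdeal.toIdeal_injective (h3.trans hyv.symm)
      exact hy.not_ge (Scheme.le_iff_specializes.mpr ((specializes_iff y x).mpr h4.le))
    · rwa [ne_eq, Order.coheight_eq_zero, isMax_iff]

theorem coheight_eq_one_of_isClosed [IsAlgClosed k] {x : ProjectiveLine k} (hx : IsClosed {x}) :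
    Order.coheight x = 1 :=
  (coheight_eq_one_iff x).mpr (asHomogeneousIdeal_ne_bot_of_isClosed hx)

theorem exists_linearForm_mem [IsAlgClosed k] {x : ProjectiveLine k} (hx : Order.coheight x = 1) :
    ∃ v : Fin 2 → k, v ≠ 0 ∧ linearForm v ∈ x.asHomogeneousIdeal := by
  obtain ⟨v, hv, h⟩ := exists_eq_span_linearForm x
    (mt (toIdeal_eq_bot_iff _).mp ((coheight_eq_one_iff x).mp hx))
  refine ⟨v, hv, ?_⟩
  rw [← HomogeneousIdeal.mem_iff, h]
  exact Ideal.mem_span_singleton_self _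

theorem det₂_ne_zero_of_ne [IsAlgClosed k] {x y : ProjectiveLine k} (hxy : x ≠ y)
    {v w : Fin 2 → k} (hv : v ≠ 0) (hw : w ≠ 0) (hxv : linearForm v ∈ x.asHomogeneousIdeal)
    (hyw : linearForm w ∈ y.asHomogeneousIdeal) : det₂ v w ≠ 0 := by
  intro h
  refine hxy (ProjectiveSpectrum.ext (HomogeneousIdeal.toIdeal_injective ?_))
  rw [eq_span_linearForm_of_mem hv hxv, eq_span_linearForm_of_mem hw hyw,
    span_linearForm_eq hv hw h]

end ProjectiveLine

/-! ### Orders of vanishing at points of codimension one. -/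

section

variable {X : Scheme.{u}} [IsIntegral X] [IsLocallyNoetherian X] [IsNormalScheme X] {x : X}

theorem exists_algebraMap_eq_of_ord_nonneg (hx : Order.coheight x = 1) {f : X.functionField}
    (hf : f ≠ 0) (h : 0 ≤ Scheme.ord f x) :
    ∃ r, algebraMap (X.presheaf.stalk x) X.functionField r = f := by
  have := isDiscreteValuationRing_stalk hx
  rw [Scheme.le_ord_iff hx hf, Scheme.ordHom, Ring.ordFrac_eq_valuation_inv] at h
  refine IsDiscreteValuationRing.exists_lift_of_le_one ?_
  have hne : (IsDiscreteValuationRing.maximalIdeal (X.presheaf.stalk x)).valuation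
      X.functionField f ≠ 0 := by simpa using hf
  exact (one_le_inv₀ (zero_lt_iff.mpr hne)).mp h

theorem one_le_ord_of_not_isUnit (hx : Order.coheight x = 1) {r : X.presheaf.stalk x} (h0 : r ≠ 0)
    (h : ¬ IsUnit r) : 1 ≤ Scheme.ord (algebraMap (X.presheaf.stalk x) X.functionField r) x := by
  have := isDiscreteValuationRing_stalk hx
  have hk : Ring.KrullDimLE 1 (X.presheaf.stalk x) := krullDimLE_of_coheight_le hx.le
  have hr : algebraMap (X.presheaf.stalk x) X.functionField r ≠ 0 := by
    rwa [ne_eq, map_eq_zero_iff _ (IsFractionRing.injective _ _)]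
  have h1 : 0 ≤ Scheme.ord (algebraMap (X.presheaf.stalk x) X.functionField r) x := by
    rw [Scheme.le_ord_iff hx hr]
    exact Ring.ordFrac_ge_one_of_ne_zero h0
  have h2 : Scheme.ord (algebraMap (X.presheaf.stalk x) X.functionField r) x ≠ 0 := by
    rw [ne_eq, Scheme.ord_eq_iff hx hr]
    exact mt Ring.isUnit_iff_ordFrac_one_of_isDiscreteValuationRing.mpr h
  omega

omit [IsNormalScheme X] in
theorem le_ord_pow {f : X.functionField} (hf : f ≠ 0) (h : 1 ≤ Scheme.ord f x) (n : ℕ) :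
    n ≤ Scheme.ord (f ^ n) x := by
  induction n with
  | zero =>
    have : Nonempty (⊤ : X.Opens) := ⟨⟨x, trivial⟩⟩
    have := Scheme.ord_of_isUnit (U := ⊤) (f := (1 : Γ(X, ⊤))) isUnit_one (x := x) trivial
    rw [map_one] at this
    simp [this]
  | succ n ih =>
    rw [pow_succ, Scheme.ord_mul (pow_ne_zero n hf) hf]
    push_cast
    omega

end

attribute [local instance] MvPolynomial.gradedAlgebra

/-! ### Frobenius splittings of the projective line from forms of degree `2 (q - 1)`. -/

namespace ProjectiveLine

open MvPolynomial

noncomputable section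

variable {k : Type u} [Field k]

local notation "𝒜" => MvPolynomial.homogeneousSubmodule (Fin 2) k

local notation "ι" => algebraMap (MvPolynomial (Fin 2) k) (FractionRing (MvPolynomial (Fin 2) k))

variable (k) in
/-- The embedding of the function field into the field of fractions of the homogeneous coordinate
ring. -/
def functionFieldToFractionRing :
    (ProjectiveLine k).functionField →+* FractionRing (MvPolynomial (Fin 2) k) :=
  Proj.stalkToFractionRing 𝒜 (genericPoint (ProjectiveLine k))

theorem functionFieldToFractionRing_algebraMap (x : ProjectiveLine k)
    (z : (ProjectiveLine k).presheaf.stalk x) :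
    functionFieldToFractionRing k (algebraMap _ _ z) = Proj.stalkToFractionRing 𝒜 x z :=
  Proj.stalkToFractionRing_stalkSpecializes 𝒜
    ((genericPoint_spec (ProjectiveLine k)).specializes trivial) z

theorem functionFieldToFractionRing_germ {U : (ProjectiveLine k).Opens} [Nonempty U]
    {x : ProjectiveLine k} (hx : x ∈ U) (s : Γ(ProjectiveLine k, U)) :
    functionFieldToFractionRing k ((ProjectiveLine k).germToFunctionField U s) =
      Proj.stalkToFractionRing 𝒜 x ((ProjectiveLine k).presheaf.germ U x hx s) := by
  rw [← Scheme.algebraMap_germ_eq_germToFunctionField _ hx, functionFieldToFractionRing_algebraMap]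

theorem germToFractionRing_injective (U : (ProjectiveLine k).Opens) [Nonempty U] :
    Function.Injective fun s : Γ(ProjectiveLine k, U) =>
      functionFieldToFractionRing k ((ProjectiveLine k).germToFunctionField U s) :=
  (RingHom.injective _).comp (Scheme.germToFunctionField_injective _ U)

/-- With `L` the linear form of `x` and `X i` nonvanishing at `x`, the quotient `t = L / X i` is a
nonunit of the local ring, so it has order at least one. Hence `f t ^ n` is regular at `x`, and
clearing `X i ^ n` gives the fraction. -/
theorem exists_fraction_of_ord [IsAlgClosed k] {x : ProjectiveLine k} (hx : Order.coheight x = 1)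
    {v : Fin 2 → k} (hv : v ≠ 0) (hxv : linearForm v ∈ x.asHomogeneousIdeal)
    {f : (ProjectiveLine k).functionField} {n : ℕ} (hf : f = 0 ∨ 0 ≤ Scheme.ord f x + n) :
    ∃ (d : ℕ) (a b : MvPolynomial (Fin 2) k), a ∈ 𝒜 (d + n) ∧ b ∈ 𝒜 d ∧
      b ∉ x.asHomogeneousIdeal ∧
      functionFieldToFractionRing k f * ι (linearForm v) ^ n = ι a / ι b := by
  by_cases hf0 : f = 0
  · refine ⟨0, 0, 1, zero_mem _, isHomogeneous_one _ _, fun h => ?_, by simp [hf0]⟩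
    exact x.isPrime.one_notMem h
  have hf := hf.resolve_left hf0
  obtain ⟨i, hi⟩ := exists_X_notMem x
  have hL := linearForm_ne_zero hv
  have hinj := IsFractionRing.injective (MvPolynomial (Fin 2) k)
    (FractionRing (MvPolynomial (Fin 2) k))
  have hιL : ι (linearForm v) ≠ 0 := algebraMap_ne_zero_of_ne_zero hL
  have hιX : ι (X i) ≠ 0 := algebraMap_ne_zero_of_ne_zero (X_ne_zero i)
  obtain ⟨t, ht⟩ := (Proj.mem_range_stalkToFractionRing_iff 𝒜 x _).mpr
    ⟨1, _, _, isHomogeneous_linearForm v, X_mem k i, hi, rfl⟩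
  have ht0 : t ≠ 0 := by
    rintro rfl
    rw [map_zero] at ht
    exact div_ne_zero hιL hιX ht.symm
  have htu : ¬ IsUnit t := by
    rintro ⟨t, rfl⟩
    obtain ⟨m, a, b, -, -, hb, hab⟩ := (Proj.mem_range_stalkToFractionRing_iff 𝒜 x
      (Proj.stalkToFractionRing 𝒜 x ↑t⁻¹)).mp ⟨_, rfl⟩
    have hb0 : b ≠ 0 := by
      rintro rfl
      exact hb (zero_mem _)
    have h1 : Proj.stalkToFractionRing 𝒜 x ↑t * Proj.stalkToFractionRing 𝒜 x ↑t⁻¹ = 1 := by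
      rw [← map_mul, Units.mul_inv, map_one]
    rw [ht, ← hab, div_mul_div_comm, div_eq_one_iff_eq
      (mul_ne_zero hιX (algebraMap_ne_zero_of_ne_zero hb0)), ← map_mul, ← map_mul] at h1
    have h2 : X i * b ∈ x.asHomogeneousIdeal.toIdeal :=
      hinj h1 ▸ Ideal.mul_mem_right _ _ hxv
    exact (x.isPrime.mem_or_mem h2).elim hi hb
  have htf : algebraMap _ (ProjectiveLine k).functionField t ≠ 0 := by
    rwa [ne_eq, map_eq_zero_iff _ (IsFractionRing.injective _ _)]
  have hord := one_le_ord_of_not_isUnit hx ht0 htu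
  have hpow := le_ord_pow htf hord n
  obtain ⟨r, hr⟩ := exists_algebraMap_eq_of_ord_nonneg hx
    (mul_ne_zero hf0 (pow_ne_zero n htf)) (by
      rw [Scheme.ord_mul hf0 (pow_ne_zero n htf)]
      omega)
  obtain ⟨d, a, b, ha, hb, hbx, hab⟩ := (Proj.mem_range_stalkToFractionRing_iff 𝒜 x
      (Proj.stalkToFractionRing 𝒜 x r)).mp ⟨_, rfl⟩
  refine ⟨d, a * X i ^ n, b, ?_, hb, hbx, ?_⟩
  · simpa using IsHomogeneous.mul ha ((isHomogeneous_X k i).pow n)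
  · rw [← functionFieldToFractionRing_algebraMap, hr, map_mul, map_pow,
      functionFieldToFractionRing_algebraMap, ht, div_pow] at hab
    rw [map_mul, map_pow, mul_div_right_comm, hab]
    field_simp

theorem exists_isHomogeneous_of_pow_dvd {F G : MvPolynomial (Fin 2) k} {m N : ℕ}
    (hF : F.IsHomogeneous m) (hG : G.IsHomogeneous N) (hG0 : G ≠ 0) (h : F ∣ G) :
    ∃ d, d + m = N ∧ ∃ H : MvPolynomial (Fin 2) k, H.IsHomogeneous d ∧ G = F * H := by
  obtain ⟨H, rfl⟩ := h
  have h1 := DirectSum.decompose_of_mem_same 𝒜 hG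
  by_cases hmN : m ≤ N
  · rw [DirectSum.coe_decompose_mul_of_left_mem_of_le 𝒜 hF hmN] at h1
    exact ⟨N - m, by omega, _, SetLike.coe_mem (DirectSum.decompose 𝒜 H (N - m)), h1.symm⟩
  · rw [DirectSum.coe_decompose_mul_of_left_mem_of_not_le 𝒜 hF hmN] at h1
    exact absurd h1.symm hG0

section Splitting

variable {p e : ℕ} [ExpChar k p] [PerfectRing k p]

/-- The factor `L ^ n` of `G` absorbs the pole of `f`, so `G f` has denominator `b`, which does not
vanish at `x`; so does its trace. -/
theorem fractionFrobeniusTrace_mem_range {x : ProjectiveLine k} {f : FractionRing _}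
    {L G a b : MvPolynomial (Fin 2) k} {d n : ℕ} (hL : L.IsHomogeneous 1)
    (hG : G.IsHomogeneous (2 * (p ^ e - 1))) (hG0 : G ≠ 0) (hLG : L ^ n ∣ G)
    (ha : a.IsHomogeneous (d + n)) (hb : b.IsHomogeneous d) (hbx : b ∉ x.asHomogeneousIdeal)
    (h : f * ι L ^ n = ι a / ι b) :
    fractionFrobeniusTrace p e (ι G * f) ∈ (Proj.stalkToFractionRing 𝒜 x).range := by
  have hq : 0 < p ^ e := pow_pos (expChar_pos k p) e
  have hb0 : b ≠ 0 := by
    rintro rfl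
    exact hbx (zero_mem _)
  obtain ⟨m, hm, H, hH, rfl⟩ := exists_isHomogeneous_of_pow_dvd (hL.pow n) hG hG0 hLG
  have h1 : ι (L ^ n * H) * f = ι (H * a) / ι b := by
    rw [map_mul, map_mul, map_pow, mul_div_assoc, ← h]
    ring
  rw [h1, fractionFrobeniusTrace_div _ _ _ hb0]
  refine (Proj.mem_range_stalkToFractionRing_iff 𝒜 x _).mpr ⟨d, _, b, ?_, hb, hbx, rfl⟩
  refine IsHomogeneous.frobeniusTrace ?_
  -- The degrees add up to `(2 (q - 1) - n) + (d + n) + d (q - 1) = q d + 2 (q - 1)`, so the trace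
  -- has degree `d`, the same as `b`.
  convert! (hH.mul ha).mul (hb.pow (p ^ e - 1)) using 1
  obtain ⟨q, hq⟩ := Nat.exists_eq_succ_of_ne_zero hq.ne'
  rw [Fintype.card_fin, ← hm, hq, Nat.succ_sub_one, Nat.succ_eq_add_one]
  ring

variable [IsAlgClosed k] {G : MvPolynomial (Fin 2) k} {E : ProjectiveLine k → ℤ}

theorem exists_section_eq_fractionFrobeniusTrace (hG : G.IsHomogeneous (2 * (p ^ e - 1)))
    (hG0 : G ≠ 0)
    (hGE : ∀ x : ProjectiveLine k, Order.coheight x = 1 → ∃ v : Fin 2 → k, v ≠ 0 ∧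
      linearForm v ∈ x.asHomogeneousIdeal ∧ linearForm v ^ (E x).toNat ∣ G)
    {U : (ProjectiveLine k).Opens} [Nonempty U] {f : (ProjectiveLine k).functionField}
    (hf : f ∈ divisorialSections E U) :
    ∃ s : Γ(ProjectiveLine k, U),
      functionFieldToFractionRing k ((ProjectiveLine k).germToFunctionField U s) =
        fractionFrobeniusTrace p e (ι G * functionFieldToFractionRing k f) := by
  obtain ⟨s, hs⟩ := Proj.exists_section_of_forall_mem_range 𝒜 (U := U)
    (f := fractionFrobeniusTrace p e (ι G * functionFieldToFractionRing k f)) fun x hxU => by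
      by_cases hx : Order.coheight x = 1
      · obtain ⟨v, hv, hxv, hvG⟩ := hGE x hx
        obtain ⟨d, a, b, ha, hb, hbx, h⟩ := exists_fraction_of_ord hx hv hxv (f := f)
          (n := (E x).toNat) (hf.imp id fun hf => by
            have := hf x hxU hx
            omega)
        exact fractionFrobeniusTrace_mem_range (isHomogeneous_linearForm v)
          hG hG0 hvG ha hb hbx h
      -- At the generic point there is no pole to absorb, and any nonzero denominator is allowed.
      · have hx0 := not_not.mp (mt (coheight_eq_one_iff x).mpr hx)
        obtain ⟨d, a, b, ha, hb, hbx, h⟩ := (Proj.mem_range_stalkToFractionRing_iff 𝒜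
          (genericPoint (ProjectiveLine k)) (functionFieldToFractionRing k f)).mp ⟨f, rfl⟩
        have hbx' : b ∉ x.asHomogeneousIdeal := by
          intro hbx'
          rw [hx0] at hbx'
          have hb0 : b = 0 := hbx'
          exact hbx (hb0 ▸ zero_mem _)
        exact fractionFrobeniusTrace_mem_range (isHomogeneous_X k 0) hG hG0
          (n := 0) (by simp) ha hb hbx' (by simp [h])
  obtain ⟨y⟩ := ‹Nonempty U›
  exact ⟨s, (functionFieldToFractionRing_germ y.2 s).trans (hs y.1 y.2)⟩

/-- All sections embed in one field of fractions, where the maps over the various open sets are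
restrictions of a single map; the axioms are checked there. -/
theorem nonempty_frobeniusSplitting (hE : ∀ x, Order.coheight x = 1 → 0 ≤ E x)
    (hG : G.IsHomogeneous (2 * (p ^ e - 1))) (hG1 : frobeniusTrace p e G = 1)
    (hGE : ∀ x : ProjectiveLine k, Order.coheight x = 1 → ∃ v : Fin 2 → k, v ≠ 0 ∧
      linearForm v ∈ x.asHomogeneousIdeal ∧ linearForm v ^ (E x).toNat ∣ G) :
    Nonempty (FrobeniusSplitting p e E) := by
  have hG0 : G ≠ 0 := by
    rintro rfl
    simp at hG1
  have h (U : (ProjectiveLine k).Opens) [Nonempty U] (f : divisorialSections E U) :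
      ∃ s : Γ(ProjectiveLine k, U),
        functionFieldToFractionRing k ((ProjectiveLine k).germToFunctionField U s) =
          fractionFrobeniusTrace p e (ι G * functionFieldToFractionRing k f.1) :=
    exists_section_eq_fractionFrobeniusTrace hG hG0 hGE f.2
  choose φ hφ using h
  refine ⟨⟨fun U _ => AddMonoidHom.mk' (φ U) fun f g => germToFractionRing_injective U ?_,
    fun U _ a f => germToFractionRing_injective U ?_,
    fun U V _ _ hVU f => germToFractionRing_injective V ?_, fun U _ s => ?_⟩⟩
  · simp only [map_add, hφ, Submodule.coe_add, mul_add]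
  · simp only [AddMonoidHom.mk'_apply, map_mul, hφ]
    rw [← fractionFrobeniusTrace_pow_mul, mul_left_comm]
    congr 2
    rw [Submodule.coe_smul, Algebra.smul_def, map_mul, map_pow, map_pow]
    rfl
  · simp only [AddMonoidHom.mk'_apply, hφ]
    rw [← hφ U f]
    congr 1
    exact ((ProjectiveLine k).presheaf.germ_res_apply _ _ _ _).symm
  · have h1 : (1 : (ProjectiveLine k).functionField) ∈ divisorialSections E U := by
      refine Or.inr fun x hx hc => ?_
      have := Scheme.ord_of_isUnit (U := U) (f := (1 : Γ(ProjectiveLine k, U))) isUnit_one hx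
      rw [map_one] at this
      rw [this, zero_add]
      exact hE x hc
    have hs : (ProjectiveLine k).germToFunctionField U s ^ p ^ e ∈ divisorialSections E U := by
      have := Submodule.smul_mem _ (s ^ p ^ e) h1
      rwa [Algebra.smul_def, mul_one, map_pow] at this
    refine ⟨hs, germToFractionRing_injective U ?_⟩
    simp only [AddMonoidHom.mk'_apply, hφ]
    rw [map_pow, mul_comm, fractionFrobeniusTrace_pow_mul, fractionFrobeniusTrace_algebraMap, hG1,
      map_one, mul_one]

end Splitting

end

end ProjectiveLine

attribute [local instance] MvPolynomial.gradedAlgebra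

section PointDivisor

variable {X : Scheme.{u}} {r : ℕ} {P : Fin r → X} {c : Fin r → ℚ}

open Classical in
theorem pointDivisor_apply [IsIntegral X] [IsLocallyNoetherian X] (x : X) :
    pointDivisor P c x = ∑ i, if P i = x then c i else 0 := by
  simp [pointDivisor, Pi.single_apply, eq_comm]

theorem pointDivisor_apply_self [IsIntegral X] [IsLocallyNoetherian X]
    (hP : Function.Injective P) (i : Fin r) : pointDivisor P c (P i) = c i := by
  simp [pointDivisor_apply, hP.eq_iff]

theorem pointDivisor_apply_of_ne [IsIntegral X] [IsLocallyNoetherian X] {x : X}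
    (hx : ∀ i, P i ≠ x) : pointDivisor P c x = 0 := by
  simp [pointDivisor_apply, hx]

end PointDivisor

/-! ### The criterion for global F-regularity and its applications. -/

namespace ProjectiveLine

open MvPolynomial

variable {k : Type u} [Field k]

local notation "𝒜" => MvPolynomial.homogeneousSubmodule (Fin 2) k

instance : CompactSpace (ProjectiveLine k) := by
  refine ⟨?_⟩
  have h : (Set.univ : Set (ProjectiveLine k)) =
      ⋃ i : Fin 2, (Proj.basicOpen 𝒜 (X i : MvPolynomial (Fin 2) k) : Set (ProjectiveLine k)) := by
    rw [← TopologicalSpace.Opens.coe_iSup, iSup_basicOpen_eq_top]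
    rfl
  rw [h]
  exact isCompact_iUnion fun i =>
    (Proj.isAffineOpen_basicOpen 𝒜 _ (X_mem k i) one_pos).isCompact

theorem exists_det₂_ne_zero {u : Fin 2 → k} (hu : u ≠ 0) : ∃ v : Fin 2 → k, det₂ u v ≠ 0 := by
  obtain ⟨i, hi⟩ := Function.ne_iff.mp hu
  fin_cases i
  · exact ⟨![0, 1], by simpa [det₂] using hi⟩
  · exact ⟨![1, 0], by simpa [det₂] using hi⟩

section

variable [IsAlgClosed k]

theorem linearForm_dvd_of_mem {x : ProjectiveLine k} {v w : Fin 2 → k} (hv : v ≠ 0) (hw : w ≠ 0)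
    (hxv : linearForm v ∈ x.asHomogeneousIdeal) (hxw : linearForm w ∈ x.asHomogeneousIdeal) :
    linearForm v ∣ linearForm w :=
  Ideal.span_singleton_le_span_singleton.mp
    (((eq_span_linearForm_of_mem hw hxw).symm.trans (eq_span_linearForm_of_mem hv hxv)).le)

theorem exists_form_of_divisor (D : AlgebraicCycle (ProjectiveLine k) ℤ) :
    ∃ (m : ℕ) (H : MvPolynomial (Fin 2) k), H.IsHomogeneous m ∧ H ≠ 0 ∧
      ∀ (x : ProjectiveLine k) (v : Fin 2 → k), Order.coheight x = 1 → v ≠ 0 →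
        linearForm v ∈ x.asHomogeneousIdeal → linearForm v ^ (D x).toNat ∣ H := by
  have hfin : (Set.univ ∩ Function.support D).Finite :=
    D.locallyFiniteSupport.finite_inter_support_of_isCompact isCompact_univ
  rw [Set.univ_inter] at hfin
  have h (x : ProjectiveLine k) : ∃ v : Fin 2 → k, v ≠ 0 ∧
      (Order.coheight x = 1 → linearForm v ∈ x.asHomogeneousIdeal) := by
    by_cases hx : Order.coheight x = 1
    · obtain ⟨v, hv, hxv⟩ := exists_linearForm_mem hx
      exact ⟨v, hv, fun _ => hxv⟩
    · exact ⟨1, one_ne_zero, fun h => absurd h hx⟩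
  choose w hw hxw using h
  refine ⟨_, ∏ x ∈ hfin.toFinset, linearForm (w x) ^ (D x).toNat,
    IsHomogeneous.prod _ _ _ fun x _ => (isHomogeneous_linearForm (w x)).pow _,
    Finset.prod_ne_zero_iff.mpr fun x _ => pow_ne_zero _ (linearForm_ne_zero (hw x)),
    fun x v hx hv hxv => ?_⟩
  by_cases h0 : D x = 0
  · simp [h0]
  · exact (pow_dvd_pow_of_dvd (linearForm_dvd_of_mem hv (hw x) hxv (hxw x hx)) _).trans
      (Finset.dvd_prod_of_mem _ (hfin.mem_toFinset.mpr h0))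

variable {p : ℕ} [CharP k p] [hp : Fact p.Prime]

/-- No exponent in a form of degree `m` exceeds `m < p ^ m`. -/
theorem exists_isFrobeniusCompatible {H : MvPolynomial (Fin 2) k} {m : ℕ}
    (hH : H.IsHomogeneous m) (hH0 : H ≠ 0) : IsFrobeniusCompatible p m H := by
  obtain ⟨d, hd⟩ := ne_zero_iff.mp hH0
  refine isFrobeniusCompatible_of_coeff_ne_zero hH hd fun i => ?_
  have h1 : d.degree = m := (weight_one_eq_degree d).symm.trans (hH hd)
  calc d i ≤ d.degree := Finsupp.le_degree i d
    _ = m := h1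
    _ < p ^ m := Nat.lt_pow_self hp.out.one_lt

/-- A criterion for global F-regularity on the projective line: it suffices that a single form,
whose divisor is at least `p ^ e Δ`, is compatible with the `e`-th Frobenius. -/
theorem isGloballyFRegular_of_isFrobeniusCompatible {Δ : AlgebraicCycle (ProjectiveLine k) ℚ}
    (hΔ : IsWeilDivisor Δ) (hΔ0 : 0 ≤ Δ) {e : ℕ} (he : 0 < e) {F : MvPolynomial (Fin 2) k}
    (hF : IsFrobeniusCompatible p e F)
    (hFΔ : ∀ (x : ProjectiveLine k) (v : Fin 2 → k), Order.coheight x = 1 → v ≠ 0 →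
      linearForm v ∈ x.asHomogeneousIdeal → ∃ n : ℕ, linearForm v ^ n ∣ F ∧ Δ x * p ^ e ≤ n) :
    IsGloballyFRegular p Δ := by
  refine ⟨hΔ, hΔ0, fun D hD hD0 => ?_⟩
  obtain ⟨m, H, hH, hH0, hHD⟩ := exists_form_of_divisor D
  obtain ⟨G, hG, hdvd, hG1⟩ := hF.pow_mul (exists_isFrobeniusCompatible (p := p) hH hH0)
  have hΔx (x : ProjectiveLine k) : 0 ≤ Δ x := hΔ0 x
  have hDx (x : ProjectiveLine k) : 0 ≤ D x := hD0 x
  have hp1 : (1 : ℚ) ≤ (p : ℚ) ^ (e + m) := one_le_pow₀ (by exact_mod_cast hp.out.one_le)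
  refine ⟨e + m, Nat.add_pos_left he m, nonempty_frobeniusSplitting (fun x _ => ?_) hG hG1
    fun x hx => ?_⟩
  · exact add_nonneg (Int.ceil_nonneg (mul_nonneg (sub_nonneg.mpr hp1) (hΔx x))) (hDx x)
  · obtain ⟨v, hv, hxv⟩ := exists_linearForm_mem hx
    obtain ⟨n, hn, hle⟩ := hFΔ x v hx hv hxv
    refine ⟨v, hv, hxv, dvd_trans ?_ hdvd⟩
    -- The multiplicity `n ≥ p ^ e Δ x` in `F` becomes `n p ^ m ≥ p ^ (e + m) Δ x` in `F ^ p ^ m`;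
    -- being an integer, it also bounds the rounded-up coefficient.
    have hceil : ⌈((p : ℚ) ^ (e + m) - 1) * Δ x⌉ ≤ (n * p ^ m : ℕ) := by
      rw [Int.ceil_le]
      push_cast
      calc ((p : ℚ) ^ (e + m) - 1) * Δ x ≤ (p : ℚ) ^ (e + m) * Δ x :=
            mul_le_mul_of_nonneg_right (by linarith) (hΔx x)
        _ = Δ x * p ^ e * p ^ m := by ring
        _ ≤ n * p ^ m := mul_le_mul_of_nonneg_right hle (by positivity)
    have hexp : (⌈((p : ℚ) ^ (e + m) - 1) * Δ x⌉ + D x).toNat ≤ n * p ^ m + (D x).toNat := by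
      have := hDx x
      omega
    refine (pow_dvd_pow _ hexp).trans ?_
    rw [pow_add, pow_mul]
    exact mul_dvd_mul (pow_dvd_pow_of_dvd hn _) (hHD x v hx hv hxv)

theorem isGloballyFRegular_pointDivisor {r : ℕ} {P : Fin r → ProjectiveLine k} {c : Fin r → ℚ}
    (hP : Function.Injective P) (hPc : ∀ i, IsClosed {P i}) (hc : ∀ i, 0 ≤ c i)
    {e : ℕ} (he : 0 < e) {F : MvPolynomial (Fin 2) k} (hF : IsFrobeniusCompatible p e F)
    {v : Fin r → Fin 2 → k} (hv : ∀ i, v i ≠ 0)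
    (hPv : ∀ i, linearForm (v i) ∈ (P i).asHomogeneousIdeal) {a : Fin r → ℕ}
    (hvF : ∀ i, linearForm (v i) ^ a i ∣ F) (hca : ∀ i, c i * p ^ e ≤ a i) :
    IsGloballyFRegular p (pointDivisor P c) := by
  refine isGloballyFRegular_of_isFrobeniusCompatible (fun x hx => ?_) (fun x => ?_) he hF
    fun x w hx hw hxw => ?_
  · obtain ⟨i, rfl⟩ : ∃ i, P i = x := by
      by_contra! h
      exact hx (pointDivisor_apply_of_ne h)
    exact coheight_eq_one_of_isClosed (hPc i)
  · change 0 ≤ pointDivisor P c x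
    by_cases h : ∃ i, P i = x
    · obtain ⟨i, rfl⟩ := h
      rw [pointDivisor_apply_self hP]
      exact hc i
    · push Not at h
      rw [pointDivisor_apply_of_ne h]
  · by_cases h : ∃ i, P i = x
    · obtain ⟨i, rfl⟩ := h
      refine ⟨a i, (pow_dvd_pow_of_dvd (linearForm_dvd_of_mem hw (hv i) hxw (hPv i)) _).trans
        (hvF i), ?_⟩
      rw [pointDivisor_apply_self hP]
      exact hca i
    · push Not at h
      exact ⟨0, by simp, by simp [pointDivisor_apply_of_ne h]⟩

theorem isGloballyFRegular_three_points {P : Fin 3 → ProjectiveLine k} {c : Fin 3 → ℚ}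
    (hP : Function.Injective P) (hPc : ∀ i, IsClosed {P i}) (hc : ∀ i, 0 ≤ c i)
    {e a₀ a₁ a₂ : ℕ} (he : 0 < e) (h : HasSmallDigitSums p e a₀ a₁ a₂)
    (h₀ : c 0 * p ^ e ≤ a₀) (h₁ : c 1 * p ^ e ≤ a₁) (h₂ : c 2 * p ^ e ≤ a₂) :
    IsGloballyFRegular p (pointDivisor P c) := by
  choose v hv hPv using fun i => exists_linearForm_mem (coheight_eq_one_of_isClosed (hPc i))
  have hdet {i j : Fin 3} (hij : i ≠ j) : det₂ (v i) (v j) ≠ 0 :=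
    det₂_ne_zero_of_ne (hP.ne hij) (hv i) (hv j) (hPv i) (hPv j)
  refine isGloballyFRegular_pointDivisor hP hPc hc he (a := ![a₀, a₁, a₂])
    (h.isFrobeniusCompatible (hdet (i := 0) (j := 1) (by decide))
      (hdet (i := 0) (j := 2) (by decide)) (hdet (i := 1) (j := 2) (by decide))) hv hPv ?_ ?_
  · intro i
    fin_cases i
    · exact (dvd_mul_right _ _).mul_right _
    · exact (dvd_mul_left _ _).mul_right _
    · exact dvd_mul_left _ _
  · intro i
    fin_cases i
    · exact h₀
    · exact h₁
    · exact h₂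

theorem isFrobeniusCompatible_pair {u v : Fin 2 → k} (huv : det₂ u v ≠ 0) (e : ℕ) :
    ∃ a : ℕ, p ^ e ≤ a + 1 ∧ IsFrobeniusCompatible p e (linearForm u ^ a * linearForm v ^ a) := by
  obtain ⟨a, h, ha⟩ := exists_hasSmallDigitSums_two (p := p) e
  refine ⟨a, ha, ?_⟩
  -- The form of `u + v` serves as a third form, with exponent `0`.
  have h1 : det₂ u (u + v) ≠ 0 := by
    convert! huv using 1
    simp only [det₂, Pi.add_apply]
    ring
  have h2 : det₂ v (u + v) ≠ 0 := by
    rw [← neg_ne_zero]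
    convert! huv using 1
    simp only [det₂, Pi.add_apply]
    ring
  simpa using h.isFrobeniusCompatible huv h1 h2

/-- Here `(d - 1) / d * q = q - q / d`, and a shortfall of `s` is harmless as long as `s ≤ q / d`.
-/
theorem sub_one_div_mul_le {d q a s : ℕ} (hd : 1 ≤ d) (hs : d * s ≤ q) (h : q ≤ a + s) :
    ((d : ℚ) - 1) / d * q ≤ a := by
  have hd' : (0 : ℚ) < d := by exact_mod_cast hd
  have hs' : (d : ℚ) * s ≤ q := by exact_mod_cast hs
  have h' : (q : ℚ) ≤ a + s := by exact_mod_cast h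
  rw [div_mul_eq_mul_div, div_le_iff₀ hd']
  nlinarith

theorem isGloballyFRegular_of_le_two {r : ℕ} (hr : r ≤ 2) {P : Fin r → ProjectiveLine k}
    {d : Fin r → ℕ} (hP : Function.Injective P) (hPc : ∀ i, IsClosed {P i}) (hd : ∀ i, 1 ≤ d i) :
    IsGloballyFRegular p (pointDivisor P fun i => ((d i : ℚ) - 1) / (d i : ℚ)) := by
  choose v hv hPv using fun i => exists_linearForm_mem (coheight_eq_one_of_isClosed (hPc i))
  have hc (i : Fin r) : 0 ≤ ((d i : ℚ) - 1) / (d i : ℚ) :=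
    div_nonneg (sub_nonneg.mpr (by exact_mod_cast hd i)) (Nat.cast_nonneg _)
  -- Fewer than two points are completed to a pair of independent forms.
  obtain ⟨w₀, w₁, hw, hvw⟩ : ∃ w₀ w₁ : Fin 2 → k, det₂ w₀ w₁ ≠ 0 ∧ ∀ i, v i = w₀ ∨ v i = w₁ := by
    interval_cases r
    · exact ⟨![1, 0], ![0, 1], by simp [det₂], fun i => i.elim0⟩
    · obtain ⟨w, hw⟩ := exists_det₂_ne_zero (hv 0)
      exact ⟨v 0, w, hw, fun i => Or.inl (congrArg v (Subsingleton.elim i 0))⟩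
    · refine ⟨v 0, v 1, det₂_ne_zero_of_ne (hP.ne (by decide)) (hv 0) (hv 1) (hPv 0) (hPv 1),
        fun i => ?_⟩
      fin_cases i
      · exact Or.inl rfl
      · exact Or.inr rfl
  -- Large enough that `d i ≤ p ^ e` for all `i`, so that the exponent `p ^ e - 1` covers `(1 - 1 /
  -- d i) p ^ e`.
  let e := 1 + ∑ i, d i
  obtain ⟨a, ha, hF⟩ := isFrobeniusCompatible_pair (p := p) hw e
  refine isGloballyFRegular_pointDivisor hP hPc hc (Nat.add_pos_left one_pos _) hF hv hPv
    (a := fun _ => a) (fun i => ?_) fun i => ?_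
  · rcases hvw i with h | h
    · rw [h]
      exact dvd_mul_right _ _
    · rw [h]
      exact dvd_mul_left _ _
  · have hdi : d i * 1 ≤ p ^ e := by
      calc d i * 1 ≤ ∑ i, d i := by
            rw [mul_one]
            exact Finset.single_le_sum (fun _ _ => Nat.zero_le _) (Finset.mem_univ i)
        _ ≤ e := Nat.le_add_left _ _
        _ ≤ p ^ e := (Nat.lt_pow_self hp.out.one_lt).le
    exact_mod_cast sub_one_div_mul_le (hd i) hdi ha

/-- Upper bounds on the coefficients let `(2, 3, 3)` and `(2, 3, 4)` be handled by the digits found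
for `(2, 3, 5)`. -/
theorem isGloballyFRegular_two_three_five (h5 : 5 < p) {P : Fin 3 → ProjectiveLine k}
    (hP : Function.Injective P) (hPc : ∀ i, IsClosed {P i}) {c : Fin 3 → ℚ} (hc : ∀ i, 0 ≤ c i)
    (h₀ : c 0 ≤ 1 / 2) (h₁ : c 1 ≤ 2 / 3) (h₂ : c 2 ≤ 4 / 5) :
    IsGloballyFRegular p (pointDivisor P c) := by
  obtain ⟨e, a₀, a₁, a₂, he, h, ha₀, ha₁, ha₂⟩ := exists_hasSmallDigitSums_two_three_five h5
  have hpos : (0 : ℚ) < (p : ℚ) ^ e := pow_pos (by exact_mod_cast hp.out.pos) e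
  have ha₀' : (p : ℚ) ^ e ≤ 2 * a₀ := by exact_mod_cast ha₀
  have ha₁' : 2 * (p : ℚ) ^ e ≤ 3 * a₁ := by exact_mod_cast ha₁
  have ha₂' : 4 * (p : ℚ) ^ e ≤ 5 * a₂ := by exact_mod_cast ha₂
  have m₀ := mul_le_mul_of_nonneg_right h₀ hpos.le
  have m₁ := mul_le_mul_of_nonneg_right h₁ hpos.le
  have m₂ := mul_le_mul_of_nonneg_right h₂ hpos.le
  exact isGloballyFRegular_three_points hP hPc hc he h (by linarith) (by linarith) (by linarith)

end

end ProjectiveLine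

theorem mainTheorem12 (k : Type u) [Field k] [IsAlgClosed k] (p : ℕ) [CharP k p] (hp : 5 < p) :
    (∀ P : Fin 3 → ProjectiveLine k, Function.Injective P → (∀ i, IsClosed {P i}) →
      IsGloballyFRegular p (pointDivisor P ![2 / 5, 2 / 3, 5 / 6]) ∧
      IsGloballyFRegular p (pointDivisor P ![1 / 3, 3 / 4, 3 / 4])) ∧
    (∀ (r : ℕ) (P : Fin r → ProjectiveLine k) (d : Fin r → ℕ), r ≤ 2 →
      Function.Injective P → (∀ i, IsClosed {P i}) → (∀ i, 1 ≤ d i) →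
      IsGloballyFRegular p (pointDivisor P fun i => ((d i : ℚ) - 1) / (d i : ℚ))) ∧
    (∀ (P : Fin 3 → ProjectiveLine k) (d : Fin 3 → ℕ),
      Function.Injective P → (∀ i, IsClosed {P i}) →
      ((∃ n : ℕ, 1 ≤ n ∧ d = ![2, 2, n]) ∨ d = ![2, 3, 3] ∨ d = ![2, 3, 4] ∨ d = ![2, 3, 5]) →
      IsGloballyFRegular p (pointDivisor P fun i => ((d i : ℚ) - 1) / (d i : ℚ))) := by
  have hprime : Fact p.Prime := ⟨(CharP.char_is_prime_or_zero k p).resolve_right (by omega)⟩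
  refine ⟨fun P hP hPc => ⟨?_, ?_⟩, fun r P d hr hP hPc hd =>
    ProjectiveLine.isGloballyFRegular_of_le_two hr hP hPc hd, fun P d hP hPc h => ?_⟩
  · obtain ⟨e, a, b, c, he, h, ha, hb, hc⟩ := MvPolynomial.exists_hasSmallDigitSums_two_fifths hp
    have ha' : 2 * (p : ℚ) ^ e ≤ 5 * a := by exact_mod_cast ha
    have hb' : 2 * (p : ℚ) ^ e ≤ 3 * b := by exact_mod_cast hb
    have hc' : 5 * (p : ℚ) ^ e ≤ 6 * c := by exact_mod_cast hc
    refine ProjectiveLine.isGloballyFRegular_three_points hP hPc (fun i => ?_) he h ?_ ?_ ?_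
    · fin_cases i <;> norm_num [Matrix.cons_val]
    · simp only [Matrix.cons_val]
      linarith
    · simp only [Matrix.cons_val]
      linarith
    · simp only [Matrix.cons_val]
      linarith
  · obtain ⟨e, a, b, c, he, h, ha, hb, hc⟩ := MvPolynomial.exists_hasSmallDigitSums_one_third hp
    have ha' : (p : ℚ) ^ e ≤ 3 * a := by exact_mod_cast ha
    have hb' : 3 * (p : ℚ) ^ e ≤ 4 * b := by exact_mod_cast hb
    have hc' : 3 * (p : ℚ) ^ e ≤ 4 * c := by exact_mod_cast hc
    refine ProjectiveLine.isGloballyFRegular_three_points hP hPc (fun i => ?_) he h ?_ ?_ ?_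
    · fin_cases i <;> norm_num [Matrix.cons_val]
    · simp only [Matrix.cons_val]
      linarith
    · simp only [Matrix.cons_val]
      linarith
    · simp only [Matrix.cons_val]
      linarith
  · have hd (i : Fin 3) : 1 ≤ d i := by
      rcases h with ⟨n, hn, rfl⟩ | h
      · fin_cases i <;> simp [hn]
      · rcases h with rfl | rfl | rfl <;> fin_cases i <;> simp
    have hc (i : Fin 3) : 0 ≤ ((d i : ℚ) - 1) / (d i : ℚ) :=
      div_nonneg (sub_nonneg.mpr (by exact_mod_cast hd i)) (Nat.cast_nonneg _)
    rcases h with ⟨n, hn, rfl⟩ | h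
    -- With `n + 1` digits the shortfall `p` of the third exponent satisfies `n p ≤ p ^ (n + 1)`, as
    -- needed for the coefficient `(n - 1) / n`.
    · obtain ⟨a, c, h, ha, hc'⟩ := MvPolynomial.exists_hasSmallDigitSums_two_two hp n
      have ha' : (p : ℚ) ^ (n + 1) ≤ 2 * a := by exact_mod_cast ha
      refine ProjectiveLine.isGloballyFRegular_three_points hP hPc hc (e := n + 1) n.succ_pos h ?_ ?_ ?_
      · norm_num [Matrix.cons_val]
        linarith
      · norm_num [Matrix.cons_val]
        linarith
      · have hs : n * p ≤ p ^ (n + 1) := by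
          rw [pow_succ]
          exact Nat.mul_le_mul_right _ (Nat.lt_pow_self hprime.out.one_lt).le
        have := ProjectiveLine.sub_one_div_mul_le hn hs hc'
        push_cast at this
        exact this
    · refine ProjectiveLine.isGloballyFRegular_two_three_five hp hP hPc hc ?_ ?_ ?_ <;>
        rcases h with rfl | rfl | rfl <;> simp only [Matrix.cons_val] <;> norm_num
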